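/- Let $X$ be a complex Banach space with open unit ball $\mathbb{B}$, and let $H(\mathbb{B})$ be the set of holomorphic (complex Fréchet differentiable) functions $\mathbb{B}\to\mathbb{C}$. For $f\in H(\mathbb{B})$ let $\mathcal{R}f(z)=Df(z)z$ be its radial derivative, where $Df(z)$ is the Fréchet derivative. A positive continuous function $\omega$ on $[0,1)$ is called normal if there are $\delta\in[0,1)$ and $0<a<b<\infty$ such that on $[\delta,1)$ the function $\omega(r)/(1-r)^a$ is decreasing and $\omega(r)/(1-r)^b$ is increasing; put $\omega(z)=\omega(\|z\|)$ for $z\in\mathbb{B}$. The Bloch-type space $\mathcal{B}_{\mathcal{R}}(\mathbb{B})_\omega$ consists of all $f\in H(\mathbb{B})$ with $\sup_{z\in\mathbb{B}}\omega(z)|\mathcal{R}f(z)|<\infty$, with the norm $|f(0)|+\sup_{z\in\mathbb{B}}\omega(z)|\mathcal{R}f(z)|$. For $\varphi\in H(\mathbb{B})$ the extended Cesàro operator is \[ T_\varphi f(z)=\int_0^1 f(tz)\,\mathcal{R}\varphi(tz)\,\frac{dt}{t},\qquad f\in H(\mathbb{B}),\ z\in\mathbb{B}. \] Theorem 4.2.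 Let $\omega$ and $\mu$ be normal functions and let $\varphi\in H(\mathbb{B})$ be such that for all $\varepsilon>0$ and $\rho\in(0,1)$ the set \[ E_{\varepsilon,\rho}=\{z\in\mathbb{B}:\ \|z\|\le\rho,\ \exists\, s\in[1,\rho^{-1}]\text{ with } sz\in\mathbb{B}\text{ and }\mu(sz)|\mathcal{R}\varphi(sz)|\ge\varepsilon\} \] is relatively compact in $\mathbb{B}$ (that is, contained in a compact subset of $\mathbb{B}$). (i) If $\int_0^1\frac{dt}{\omega(t)}<\infty$, then $T_\varphi$ is a compact operator from $\mathcal{B}_{\mathcal{R}}(\mathbb{B})_\omega$ to $\mathcal{B}_{\mathcal{R}}(\mathbb{B})_\mu$ if and only if $\varphi\in\mathcal{B}_{\mathcal{R}}(\mathbb{B})_\mu$. (ii) If $\int_0^1\frac{dt}{\omega(t)}=\infty$, then $T_\varphi$ is a compact operator from $\mathcal{B}_{\mathcal{R}}(\mathbb{B})_\omega$ to $\mathcal{B}_{\mathcal{R}}(\mathbb{B})_\mu$ if and only if \[ \lim_{\|z\|\to1}\mu(z)|\mathcal{R}\varphi(z)|\int_0^{\|z\|}\frac{dt}{\omega(t)}=0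 . \] Here "$T_\varphi$ is a compact operator from $\mathcal{B}_{\mathcal{R}}(\mathbb{B})_\omega$ to $\mathcal{B}_{\mathcal{R}}(\mathbb{B})_\mu$" includes that $T_\varphi$ maps the first space into the second. -/

import Mathlib

open Set Filter Topology MeasureTheory

noncomputable section

namespace BlochBall

/-- A normal function: a positive continuous function on `[0, 1)` such that, for some
`δ ∈ [0, 1)` and `0 < a < b`, on `[δ, 1)` the quotient `ω r / (1 - r) ^ a` is decreasing and
`ω r / (1 - r) ^ b` is increasing. Values outside `[0, 1)` are irrelevant. -/
structure NormalFunction where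
  toFun : ℝ → ℝ
  pos : ∀ r ∈ Ico (0 : ℝ) 1, 0 < toFun r
  continuousOn : ContinuousOn toFun (Ico 0 1)
  normal : ∃ δ ∈ Ico (0 : ℝ) 1, ∃ a b : ℝ, 0 < a ∧ a < b ∧
    AntitoneOn (fun r => toFun r / (1 - r) ^ a) (Ico δ 1) ∧
    MonotoneOn (fun r => toFun r / (1 - r) ^ b) (Ico δ 1)

instance : CoeFun NormalFunction (fun _ => ℝ → ℝ) := ⟨NormalFunction.toFun⟩

variable {X : Type*} [NormedAddCommGroup X]

open Classical in
/-- Extension by zero to `X` of a function on the open unit ball `𝔹`. -/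
def extendZero (f : Metric.ball (0 : X) 1 → ℂ) : X → ℂ :=
  fun z => if h : z ∈ Metric.ball (0 : X) 1 then f ⟨z, h⟩ else 0

theorem extendZero_coe (f : Metric.ball (0 : X) 1 → ℂ) (z : Metric.ball (0 : X) 1) :
    extendZero f z = f z := by
  simp [extendZero]

theorem extendZero_add (f g : Metric.ball (0 : X) 1 → ℂ) :
    extendZero (f + g) = extendZero f + extendZero g := by
  ext z
  by_cases h : ‖z‖ < 1 <;> simp [extendZero, h]

theorem extendZero_smul (c : ℂ) (f : Metric.ball (0 : X) 1 → ℂ) :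
    extendZero (c • f) = c • extendZero f := by
  ext z
  by_cases h : ‖z‖ < 1 <;> simp [extendZero, h]

theorem extendZero_zero : extendZero (0 : Metric.ball (0 : X) 1 → ℂ) = 0 := by
  ext z
  simp [extendZero]

theorem NormalFunction.pos_norm (ω : NormalFunction) (z : Metric.ball (0 : X) 1) :
    0 < ω ‖(z : X)‖ :=
  ω.pos _ ⟨norm_nonneg _, mem_ball_zero_iff.mp z.2⟩

variable [NormedSpace ℂ X]

/-- `f` is holomorphic on the open unit ball: it is complex Fréchet differentiable at each of
its points. -/
def IsHolomorphic (f : Metric.ball (0 : X) 1 → ℂ) : Prop :=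
  DifferentiableOn ℂ (extendZero f) (Metric.ball (0 : X) 1)

/-- The radial derivative `ℛ f (z) = Df(z) z` (used only at points of the open unit ball). -/
def radialDeriv (f : Metric.ball (0 : X) 1 → ℂ) (z : X) : ℂ :=
  fderiv ℂ (extendZero f) z z

theorem IsHolomorphic.differentiableAt {f : Metric.ball (0 : X) 1 → ℂ} (hf : IsHolomorphic f)
    {z : X} (hz : z ∈ Metric.ball (0 : X) 1) : DifferentiableAt ℂ (extendZero f) z :=
  DifferentiableOn.differentiableAt hf (Metric.isOpen_ball.mem_nhds hz)

theorem radialDeriv_add {f g : Metric.ball (0 : X) 1 → ℂ} (hf : IsHolomorphic f)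
    (hg : IsHolomorphic g) {z : X} (hz : z ∈ Metric.ball (0 : X) 1) :
    radialDeriv (f + g) z = radialDeriv f z + radialDeriv g z := by
  simp only [radialDeriv, extendZero_add]
  rw [fderiv_add (hf.differentiableAt hz) (hg.differentiableAt hz)]
  rfl

theorem radialDeriv_smul (c : ℂ) {f : Metric.ball (0 : X) 1 → ℂ} (hf : IsHolomorphic f)
    {z : X} (hz : z ∈ Metric.ball (0 : X) 1) :
    radialDeriv (c • f) z = c * radialDeriv f z := by
  simp only [radialDeriv, extendZero_smul]
  rw [fderiv_const_smul (hf.differentiableAt hz)]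
  rfl

theorem radialDeriv_zero (z : X) :
    radialDeriv (0 : Metric.ball (0 : X) 1 → ℂ) z = 0 := by
  simp [radialDeriv, extendZero_zero]

/-- The weighted quantity `ω(z) |ℛ f (z)|`, with `ω(z) = ω(‖z‖)`. -/
def weighted (ω : NormalFunction) (f : Metric.ball (0 : X) 1 → ℂ)
    (z : Metric.ball (0 : X) 1) : ℝ :=
  ω ‖(z : X)‖ * ‖radialDeriv f (z : X)‖

theorem weighted_nonneg (ω : NormalFunction) (f : Metric.ball (0 : X) 1 → ℂ)
    (z : Metric.ball (0 : X) 1) : 0 ≤ weighted ω f z :=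
  mul_nonneg (ω.pos_norm z).le (norm_nonneg _)

theorem weighted_add_le (ω : NormalFunction) {f g : Metric.ball (0 : X) 1 → ℂ}
    (hf : IsHolomorphic f) (hg : IsHolomorphic g) (z : Metric.ball (0 : X) 1) :
    weighted ω (f + g) z ≤ weighted ω f z + weighted ω g z := by
  unfold weighted
  rw [radialDeriv_add hf hg z.2, ← mul_add]
  exact mul_le_mul_of_nonneg_left (norm_add_le _ _) (ω.pos_norm z).le

theorem weighted_smul (ω : NormalFunction) (c : ℂ) {f : Metric.ball (0 : X) 1 → ℂ}
    (hf : IsHolomorphic f) (z : Metric.ball (0 : X) 1) :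
    weighted ω (c • f) z = ‖c‖ * weighted ω f z := by
  unfold weighted
  rw [radialDeriv_smul c hf z.2, norm_mul]
  ring

/-- Membership in the Bloch-type space: `f` is holomorphic on the open unit ball and
`sup ω(z) |ℛ f (z)| < ∞`. -/
def MemBloch (ω : NormalFunction) (f : Metric.ball (0 : X) 1 → ℂ) : Prop :=
  IsHolomorphic f ∧ BddAbove (range (weighted ω f))

variable (X) in
/-- The Bloch-type space as a linear subspace of the functions on the open unit ball. -/
def blochSubmodule (ω : NormalFunction) : Submodule ℂ (Metric.ball (0 : X) 1 → ℂ) where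
  carrier := {f | MemBloch ω f}
  add_mem' := by
    rintro f g ⟨hf, A, hA⟩ ⟨hg, B, hB⟩
    refine ⟨?_, A + B, ?_⟩
    · unfold IsHolomorphic
      rw [extendZero_add]
      exact DifferentiableOn.add hf hg
    · rintro _ ⟨z, rfl⟩
      exact (weighted_add_le ω hf hg z).trans (add_le_add (hA ⟨z, rfl⟩) (hB ⟨z, rfl⟩))
  zero_mem' := by
    refine ⟨?_, 0, ?_⟩
    · unfold IsHolomorphic
      rw [extendZero_zero]
      exact differentiableOn_const 0
    · rintro _ ⟨z, rfl⟩
      simp [weighted, radialDeriv_zero]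
  smul_mem' := by
    rintro c f ⟨hf, A, hA⟩
    refine ⟨?_, ‖c‖ * A, ?_⟩
    · unfold IsHolomorphic
      rw [extendZero_smul]
      exact DifferentiableOn.const_smul hf c
    · rintro _ ⟨z, rfl⟩
      rw [weighted_smul ω c hf]
      exact mul_le_mul_of_nonneg_left (hA ⟨z, rfl⟩) (norm_nonneg c)

variable (X) in
/-- The Bloch-type space with weight `ω`. It is a type of its own, so that it carries the
topology of the norm defined below and not that of pointwise convergence. -/
def BlochSpace (ω : NormalFunction) : Type _ := ↥(blochSubmodule X ω)

namespace BlochSpace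

variable {ω : NormalFunction}

instance : AddCommGroup (BlochSpace X ω) :=
  inferInstanceAs (AddCommGroup ↥(blochSubmodule X ω))

instance : Module ℂ (BlochSpace X ω) :=
  inferInstanceAs (Module ℂ ↥(blochSubmodule X ω))

instance : FunLike (BlochSpace X ω) (Metric.ball (0 : X) 1) ℂ where
  coe f := Subtype.val f
  coe_injective _ _ h := Subtype.ext h

theorem mem (f : BlochSpace X ω) : MemBloch ω (f : Metric.ball (0 : X) 1 → ℂ) :=
  Subtype.property f

theorem coe_add (f g : BlochSpace X ω) : (⇑(f + g) : Metric.ball (0 : X) 1 → ℂ) = ⇑f + ⇑g := rfl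

theorem coe_smul (c : ℂ) (f : BlochSpace X ω) :
    (⇑(c • f) : Metric.ball (0 : X) 1 → ℂ) = c • ⇑f := rfl

theorem coe_zero : (⇑(0 : BlochSpace X ω) : Metric.ball (0 : X) 1 → ℂ) = 0 := rfl

/-- The origin as a point of the open unit ball. -/
def origin : Metric.ball (0 : X) 1 := ⟨0, Metric.mem_ball_self one_pos⟩

/-- The norm `|f(0)| + sup ω(z) |ℛ f (z)|`. -/
instance : Norm (BlochSpace X ω) where
  norm f := ‖f origin‖ + ⨆ z : Metric.ball (0 : X) 1, weighted ω f z

theorem norm_def (f : BlochSpace X ω) :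
    ‖f‖ = ‖f origin‖ + ⨆ z : Metric.ball (0 : X) 1, weighted ω f z := rfl

/-- A holomorphic function on the ball with zero radial derivative that vanishes at the origin
is zero. -/
theorem eq_zero_of_radialDeriv {f : Metric.ball (0 : X) 1 → ℂ} (hf : IsHolomorphic f)
    (h0 : f origin = 0) (hR : ∀ z ∈ Metric.ball (0 : X) 1, radialDeriv f z = 0) : f = 0 := by
  funext z
  have hz : ‖(z : X)‖ < 1 := mem_ball_zero_iff.mp z.2
  have hmem : ∀ t ∈ Icc (0 : ℝ) 1, ((t : ℂ) • (z : X)) ∈ Metric.ball (0 : X) 1 := by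
    intro t ht
    rw [mem_ball_zero_iff, norm_smul, Complex.norm_real, Real.norm_of_nonneg ht.1]
    exact (mul_le_of_le_one_left (norm_nonneg _) ht.2).trans_lt hz
  have hd : ∀ t ∈ Icc (0 : ℝ) 1, HasDerivAt (fun t : ℝ => extendZero f ((t : ℂ) • (z : X)))
      (fderiv ℂ (extendZero f) ((t : ℂ) • (z : X)) z) t := by
    intro t ht
    have h1 : HasDerivAt (fun c : ℂ => c • (z : X)) (z : X) (t : ℂ) := by
      simpa using (hasDerivAt_id (t : ℂ)).smul_const (z : X)
    exact ((hf.differentiableAt (hmem t ht)).hasFDerivAt.comp_hasDerivAt (t : ℂ) h1).comp_ofReal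
  have hc := constant_of_has_deriv_right_zero
    (f := fun t : ℝ => extendZero f ((t : ℂ) • (z : X))) (a := 0) (b := 1)
    (fun t ht => (hd t ht).continuousAt.continuousWithinAt) ?_ 1 ⟨zero_le_one, le_rfl⟩
  · have h0' : extendZero f 0 = 0 := by
      rw [← h0]
      exact extendZero_coe f origin
    simpa [h0', extendZero_coe] using hc
  · intro t ht
    have ht' : t ∈ Icc (0 : ℝ) 1 := ⟨ht.1, ht.2.le⟩
    have key : fderiv ℂ (extendZero f) ((t : ℂ) • (z : X)) z = 0 := by
      rcases ht.1.eq_or_lt with h | h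
      · subst h
        -- at the origin the derivative is the limit of the derivatives along the segment
        have hline : DifferentiableOn ℂ (fun c : ℂ => extendZero f (c • (z : X)))
            (Metric.ball (0 : ℂ) 1) := by
          intro c hc
          have hcz : c • (z : X) ∈ Metric.ball (0 : X) 1 := by
            rw [mem_ball_zero_iff, norm_smul]
            have : ‖c‖ < 1 := by simpa using hc
            exact (mul_le_of_le_one_left (norm_nonneg _) this.le).trans_lt hz
          exact ((hf.differentiableAt hcz).comp c
            (differentiableAt_id.smul_const (z : X))).differentiableWithinAt
        have hval : ∀ c ∈ Metric.ball (0 : ℂ) 1,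
            deriv (fun c : ℂ => extendZero f (c • (z : X))) c
              = fderiv ℂ (extendZero f) (c • (z : X)) z := by
          intro c hc
          have hcz : c • (z : X) ∈ Metric.ball (0 : X) 1 := by
            rw [mem_ball_zero_iff, norm_smul]
            have : ‖c‖ < 1 := by simpa using hc
            exact (mul_le_of_le_one_left (norm_nonneg _) this.le).trans_lt hz
          have h1 : HasDerivAt (fun c : ℂ => c • (z : X)) (z : X) c := by
            simpa using (hasDerivAt_id c).smul_const (z : X)
          exact ((hf.differentiableAt hcz).hasFDerivAt.comp_hasDerivAt c h1).deriv
        have hcont : ContinuousAt (deriv (fun c : ℂ => extendZero f (c • (z : X)))) 0 :=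
          ((hline.deriv Metric.isOpen_ball).differentiableAt
            (Metric.isOpen_ball.mem_nhds (Metric.mem_ball_self one_pos))).continuousAt
        have hev : ∀ᶠ c in 𝓝[≠] (0 : ℂ),
            deriv (fun c : ℂ => extendZero f (c • (z : X))) c = 0 := by
          filter_upwards [self_mem_nhdsWithin, mem_nhdsWithin_of_mem_nhds
            (Metric.isOpen_ball.mem_nhds (Metric.mem_ball_self (x := (0 : ℂ)) one_pos))]
            with c hc0 hc
          rw [hval c hc]
          have hcz : c • (z : X) ∈ Metric.ball (0 : X) 1 := by
            rw [mem_ball_zero_iff, norm_smul]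
            have : ‖c‖ < 1 := by simpa using hc
            exact (mul_le_of_le_one_left (norm_nonneg _) this.le).trans_lt hz
          have := hR _ hcz
          rw [radialDeriv, map_smul, smul_eq_mul] at this
          exact (mul_eq_zero.mp this).resolve_left hc0
        have hlim := (hcont.tendsto.mono_left nhdsWithin_le_nhds).congr' hev
        have := tendsto_nhds_unique hlim tendsto_const_nhds
        rw [hval 0 (Metric.mem_ball_self one_pos)] at this
        simpa using this
      · have := hR _ (hmem t ht')
        rw [radialDeriv, map_smul, smul_eq_mul] at this
        exact (mul_eq_zero.mp this).resolve_left (by exact_mod_cast h.ne')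
    rw [← key]
    exact (hd t ht').hasDerivWithinAt

theorem normedSpaceCore : NormedSpace.Core ℂ (BlochSpace X ω) where
  norm_nonneg f := add_nonneg (norm_nonneg _) (Real.iSup_nonneg (weighted_nonneg ω f))
  norm_smul c f := by
    rw [norm_def, norm_def, mul_add, Real.mul_iSup_of_nonneg (norm_nonneg c)]
    congr 1
    · exact norm_mul c (f origin)
    · exact iSup_congr (weighted_smul ω c f.mem.1)
  norm_triangle f g := by
    have : Nonempty (Metric.ball (0 : X) 1) := ⟨origin⟩
    have h1 : ‖(f + g) origin‖ ≤ ‖f origin‖ + ‖g origin‖ := norm_add_le _ _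
    have h2 : (⨆ z, weighted ω ⇑(f + g) z) ≤ (⨆ z, weighted ω ⇑f z) + ⨆ z, weighted ω ⇑g z :=
      ciSup_le fun z => (weighted_add_le ω f.mem.1 g.mem.1 z).trans
        (add_le_add (le_ciSup f.mem.2 z) (le_ciSup g.mem.2 z))
    rw [norm_def, norm_def, norm_def]
    linarith
  norm_eq_zero_iff f := by
    constructor
    · intro h
      have hs : 0 ≤ ⨆ z : Metric.ball (0 : X) 1, weighted ω f z :=
        Real.iSup_nonneg (weighted_nonneg ω f)
      rw [norm_def] at h
      have h0 : ‖f origin‖ = 0 := by linarith [norm_nonneg (f origin)]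
      have h1 : (⨆ z : Metric.ball (0 : X) 1, weighted ω f z) = 0 := by
        linarith [norm_nonneg (f origin)]
      refine DFunLike.coe_injective (eq_zero_of_radialDeriv f.mem.1 (norm_eq_zero.mp h0) ?_)
      intro z hz
      have h2 : weighted ω f ⟨z, hz⟩ = 0 :=
        le_antisymm (h1 ▸ le_ciSup f.mem.2 ⟨z, hz⟩) (weighted_nonneg ω f _)
      exact norm_eq_zero.mp ((mul_eq_zero.mp h2).resolve_left (ω.pos_norm ⟨z, hz⟩).ne')
    · rintro rfl
      have : Nonempty (Metric.ball (0 : X) 1) := ⟨origin⟩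
      simp [norm_def, coe_zero, weighted, radialDeriv_zero]

instance : NormedAddCommGroup (BlochSpace X ω) := NormedAddCommGroup.ofCore normedSpaceCore

instance : NormedSpace ℂ (BlochSpace X ω) := NormedSpace.ofCore normedSpaceCore

end BlochSpace

/-- The extended Cesàro operator
`T_φ f (z) = ∫₀¹ f(tz) ℛφ(tz) (1/t) dt` for `z` in the open unit ball. -/
def cesaro (φ f : Metric.ball (0 : X) 1 → ℂ) (z : Metric.ball (0 : X) 1) : ℂ :=
  ∫ t in (0 : ℝ)..1, extendZero f ((t : ℂ) • (z : X)) * radialDeriv φ ((t : ℂ) • (z : X)) *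
    (1 / (t : ℂ))

/-- `T_φ` maps the Bloch-type space of `ω` into that of `μ`, and is a compact operator between
these normed spaces. -/
def CesaroCompact (ω μ : NormalFunction) (φ : Metric.ball (0 : X) 1 → ℂ) : Prop :=
  ∃ T : BlochSpace X ω →ₗ[ℂ] BlochSpace X μ,
    (∀ (f : BlochSpace X ω) (z : Metric.ball (0 : X) 1), T f z = cesaro φ f z) ∧
    IsCompactOperator T

/-- The set of the points `z` of the open unit ball with `‖z‖ ≤ ρ` such that
`μ(sz) |ℛφ(sz)| ≥ ε` for some `s ∈ [1, 1/ρ]` (for which `sz` lies in the open unit ball, where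
`μ` and `φ` are defined). -/
def exceptionalSet (μ : NormalFunction) (φ : Metric.ball (0 : X) 1 → ℂ) (ε ρ : ℝ) : Set X :=
  {z | z ∈ Metric.ball (0 : X) 1 ∧ ‖z‖ ≤ ρ ∧ ∃ s ∈ Icc (1 : ℝ) ρ⁻¹,
    ∃ h : (s : ℂ) • z ∈ Metric.ball (0 : X) 1, ε ≤ weighted μ φ ⟨(s : ℂ) • z, h⟩}

/-- `E` is relatively compact in the open unit ball. -/
def RelativelyCompactInBall (E : Set X) : Prop :=
  ∃ K : Set X, IsCompact K ∧ E ⊆ K ∧ K ⊆ Metric.ball (0 : X) 1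

end BlochBall

end

open Set Filter Topology MeasureTheory

noncomputable section

namespace BlochBall

/-! Everything rests on the identity `ℛ(T_φ f) = f ℛφ` (`radialDeriv_cesaro`). Since `T_φ f`
vanishes at the origin, its norm in the target space is `sup μ |ℛφ| |f|`, and the question becomes
how large `f` can be. Write `W(r) = ∫₀ʳ dt/ω`. Integrating the radial derivative along rays gives
`|f(z)| ≤ ‖f‖ (const + 2 W(‖z‖))` (`BlochSpace.norm_apply_le`).

Sufficiency. The closed unit ball of the source space is compact for pointwise convergence, and that
convergence is uniform on compact sets (`exists_tendsto_of_ultrafilter`,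
`eventually_forall_mem_compact`). So `T_φ` is compact once, for every `ε`, `μ |ℛφ| |f| ≤ ε + A sup_K
|f|` for some compact `K` in the ball and some `A`, uniformly over `‖f‖ ≤ 2`
(`cesaroCompact_of_forall`). In infinite dimension smaller closed balls are not compact; the
exceptional sets supply `K`. Where `μ |ℛφ|` is small, a bound on `f` suffices; where it is large and
`‖z‖ ≤ ρ`, the point lies in `K`. Outside radius `ρ` there are two arguments. If `W` is bounded, `z`
is compared with its radial projection to radius `ρ`, which lies in `K`, at a cost proportional to
`W(‖z‖) - W(ρ)`. If `W` is unbounded, it absorbs the constants in the growth bound, and the limit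
condition applies.

Necessity. For finite `W(1)`, apply `T_φ` to the constant `1`. For infinite `W(1)`,
`exists_bounded_extremal` gives a norm-bounded family `f_z` of bounded functions with `W(‖z‖) ≤ C
|f_z(z)|`. The images `T_φ f_z` are totally bounded. The finitely many functions of a net are
bounded by a common constant, so for `z` near the sphere `f_z(z)` dominates them, and the distance
from `T_φ f_z` to the net controls `μ |ℛφ| W` at `z`. The test functions are sums of Cauchy-type
kernels at the points `1 - 2⁻ᵏ`, composed with a norming functional of `z`; normality of `ω` makes
the sums geometric. -/

theorem mapsTo_closedBall_of_norm_le {E : Type*} [NormedAddCommGroup E]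
    {f : E → ℂ} {x : E} {r M : ℝ} (hr : 0 < r)
    (hM : ∀ y ∈ Metric.ball x r, ‖f y‖ ≤ M) :
    MapsTo f (Metric.ball x r) (Metric.closedBall (f x) (2 * M)) := by
  intro y hy
  rw [Metric.mem_closedBall, dist_eq_norm]
  linarith [norm_sub_le (f y) (f x), hM y hy, hM x (Metric.mem_ball_self hr)]

/-! ### Cauchy estimates, and holomorphy of limits and integrals -/

section Holomorphic

variable {E : Type*} [NormedAddCommGroup E] [NormedSpace ℂ E]

/-- Cauchy estimate for the Fréchet derivative. -/
theorem norm_fderiv_le_of_norm_le {f : E → ℂ} {x : E} {r M : ℝ} (hr : 0 < r)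
    (hd : DifferentiableOn ℂ f (Metric.ball x r)) (hM : ∀ y ∈ Metric.ball x r, ‖f y‖ ≤ M) :
    ‖fderiv ℂ f x‖ ≤ 2 * M / r :=
  Complex.norm_fderiv_le_div_of_mapsTo_ball hd (mapsTo_closedBall_of_norm_le hr hM) hr

theorem norm_sub_le_of_norm_le {f : E → ℂ} {x y : E} {r M : ℝ} (hr : 0 < r)
    (hd : DifferentiableOn ℂ f (Metric.ball x r)) (hM : ∀ y ∈ Metric.ball x r, ‖f y‖ ≤ M)
    (hy : y ∈ Metric.ball x r) : ‖f y - f x‖ ≤ 2 * M / r * ‖y - x‖ := by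
  simpa [dist_eq_norm] using
    Complex.dist_le_div_mul_dist_of_mapsTo_ball hd (mapsTo_closedBall_of_norm_le hr hM) hy

/-- Second order Taylor estimate for bounded holomorphic functions. -/
theorem norm_taylor_le_of_norm_le {f : E → ℂ} {x y : E} {r M : ℝ} (hr : 0 < r)
    (hd : DifferentiableOn ℂ f (Metric.ball x r)) (hM : ∀ y ∈ Metric.ball x r, ‖f y‖ ≤ M)
    (hy : y ∈ Metric.ball x r) :
    ‖f y - f x - fderiv ℂ f x (y - x)‖ ≤ 4 * M / r ^ 2 * ‖y - x‖ ^ 2 := by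
  have hx : DifferentiableAt ℂ f x := hd.differentiableAt (Metric.ball_mem_nhds x hr)
  -- A second-order Schwarz lemma: the remainder is `o(‖y - x‖)` at `x` and is bounded by `2M + 2M`.
  have h := Complex.dist_le_mul_div_pow_of_mapsTo_ball_of_isLittleO (n := 1) (R₂ := 4 * M)
    (f := fun y => f y - f x - fderiv ℂ f x (y - x)) (c := x) (z := y) (R₁ := r) ?_ ?_ ?_ hy
  · simp only [sub_self, map_zero, dist_zero_right] at h
    refine h.trans_eq ?_
    rw [dist_eq_norm]
    ring
  · exact (hd.sub_const _).sub ((fderiv ℂ f x).differentiable.comp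
      (differentiable_id.sub_const x)).differentiableOn
  · intro w hw
    simp only [sub_self, map_zero, mem_closedBall_zero_iff]
    have h1 : ‖f w - f x‖ ≤ 2 * M := by
      simpa [dist_eq_norm] using mapsTo_closedBall_of_norm_le hr hM hw
    have hM0 : 0 ≤ M := (norm_nonneg _).trans (hM w hw)
    have h2 : ‖fderiv ℂ f x (w - x)‖ ≤ 2 * M := by
      refine ((fderiv ℂ f x).le_of_opNorm_le (norm_fderiv_le_of_norm_le hr hd hM) _).trans ?_
      have : ‖w - x‖ ≤ r := by simpa [dist_eq_norm] using (Metric.mem_ball.mp hw).le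
      calc 2 * M / r * ‖w - x‖ ≤ 2 * M / r * r := by gcongr
        _ = 2 * M := by field_simp
    linarith [norm_sub_le (f w - f x) (fderiv ℂ f x (w - x))]
  · simp only [sub_self, map_zero, sub_zero, pow_one]
    exact hx.hasFDerivAt.isLittleO.norm_right

/-- A quadratic remainder bound survives both limits and integration, so it yields differentiability
of pointwise limits and of integrals. -/
theorem hasFDerivAt_of_taylor {f : E → ℂ} {L : E →L[ℂ] ℂ} {x : E} {r C : ℝ} (hr : 0 < r)
    (h : ∀ y ∈ Metric.ball x r, ‖f y - f x - L (y - x)‖ ≤ C * ‖y - x‖ ^ 2) :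
    HasFDerivAt f L x := by
  refine .of_isLittleO (Asymptotics.IsBigO.trans_isLittleO
    (g := fun y => ‖y - x‖ ^ 2) (.of_bound C ?_) ?_)
  · filter_upwards [Metric.ball_mem_nhds x hr] with y hy
    simpa using h y hy
  · have := (Asymptotics.isLittleO_norm_pow_id (E' := E) one_lt_two).comp_tendsto
      (tendsto_sub_nhds_zero_iff.mpr (tendsto_id (x := 𝓝 x)))
    simpa [Function.comp_def] using this

theorem Ultrafilter.exists_tendsto_of_norm_le {ι : Type*} {U : Ultrafilter ι} {u : ι → ℂ} {M : ℝ}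
    (h : ∀ᶠ i in (U : Filter ι), ‖u i‖ ≤ M) : ∃ a, ‖a‖ ≤ M ∧ Tendsto u U (𝓝 a) := by
  obtain ⟨a, ha, hU⟩ := (isCompact_closedBall (0 : ℂ) M).ultrafilter_le_nhds (U.map u)
    (le_principal_iff.mpr (Ultrafilter.mem_map.mpr <| h.mono fun i hi => by
      simpa using hi))
  exact ⟨a, by simpa using ha, hU⟩

/-- A pointwise limit of uniformly bounded holomorphic functions is holomorphic, and the
derivatives converge pointwise. -/
theorem exists_hasFDerivAt_of_tendsto {ι : Type*} {U : Ultrafilter ι} {F : ι → E → ℂ}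
    {f : E → ℂ} {x : E} {r M : ℝ} (hr : 0 < r)
    (hd : ∀ᶠ i in (U : Filter ι), DifferentiableOn ℂ (F i) (Metric.ball x r))
    (hM : ∀ᶠ i in (U : Filter ι), ∀ y ∈ Metric.ball x r, ‖F i y‖ ≤ M)
    (hf : ∀ y ∈ Metric.ball x r, Tendsto (F · y) U (𝓝 (f y))) :
    ∃ L : E →L[ℂ] ℂ, HasFDerivAt f L x ∧
      ∀ h, Tendsto (fun i => fderiv ℂ (F i) x h) U (𝓝 (L h)) := by
  have hb : ∀ h, ∃ a : ℂ, ‖a‖ ≤ 2 * M / r * ‖h‖ ∧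
      Tendsto (fun i => fderiv ℂ (F i) x h) U (𝓝 a) := by
    intro h
    refine Ultrafilter.exists_tendsto_of_norm_le ?_
    filter_upwards [hd, hM] with i hdi hMi
    exact (fderiv ℂ (F i) x).le_of_opNorm_le (norm_fderiv_le_of_norm_le hr hdi hMi) _
  choose L hL hlim using hb
  let L' : E →ₗ[ℂ] ℂ :=
    { toFun := L
      map_add' := fun h k => tendsto_nhds_unique (hlim (h + k))
        (by simpa using (hlim h).add (hlim k))
      map_smul' := fun c h => tendsto_nhds_unique (hlim (c • h))
        (by simpa using (hlim h).const_mul c) }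
  -- The remainder bound has the same constant for eventually all `i`, so it passes to the limit.
  refine ⟨L'.mkContinuous _ hL, hasFDerivAt_of_taylor (C := 4 * M / r ^ 2) hr fun y hy => ?_, hlim⟩
  refine le_of_tendsto (((hf y hy).sub (hf x (Metric.mem_ball_self hr))).sub
    (hlim (y - x))).norm ?_
  filter_upwards [hd, hM] with i hdi hMi
  exact norm_taylor_le_of_norm_le hr hdi hMi hy

/-- An integral of uniformly bounded holomorphic functions is holomorphic. -/
theorem differentiableAt_integral {α : Type*} [MeasurableSpace α] {ν : Measure α}
    [IsFiniteMeasure ν] {H : α → E → ℂ} {x : E} {r M : ℝ} (hr : 0 < r)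
    (hd : ∀ᵐ a ∂ν, DifferentiableOn ℂ (H a) (Metric.ball x r))
    (hM : ∀ᵐ a ∂ν, ∀ y ∈ Metric.ball x r, ‖H a y‖ ≤ M)
    (hm : ∀ y ∈ Metric.ball x r, AEStronglyMeasurable (H · y) ν) :
    DifferentiableAt ℂ (fun y => ∫ a, H a y ∂ν) x := by
  have hint : ∀ y ∈ Metric.ball x r, Integrable (H · y) ν := fun y hy =>
    .of_bound (hm y hy) M (hM.mono fun a ha => ha y hy)
  have hbd : ∀ h, ∀ᵐ a ∂ν, ‖fderiv ℂ (H a) x h‖ ≤ 2 * M / r * ‖h‖ := by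
    intro h
    filter_upwards [hd, hM] with a hda hMa
    exact (fderiv ℂ (H a) x).le_of_opNorm_le (norm_fderiv_le_of_norm_le hr hda hMa) _
  have hxr : x ∈ Metric.ball x r := Metric.mem_ball_self hr
  -- Only the values are assumed measurable in `a`, so the derivative is realised as a limit of
  -- difference quotients; the shift by `N` keeps the sample points in the ball.
  have hmeas : ∀ h, AEStronglyMeasurable (fun a => fderiv ℂ (H a) x h) ν := by
    intro h
    have hlim0 : Tendsto (fun n : ℕ => ((n : ℂ) + 1)⁻¹) atTop (𝓝 0) := by
      have := tendsto_one_div_add_atTop_nhds_zero_nat (𝕜 := ℂ)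
      simpa using this
    have hlimx : Tendsto (fun n : ℕ => x + ((n : ℂ) + 1)⁻¹ • h) atTop (𝓝 x) := by
      simpa using (hlim0.smul_const h).const_add x
    obtain ⟨N, hN⟩ := eventually_atTop.mp (hlimx.eventually (Metric.ball_mem_nhds x hr))
    refine aestronglyMeasurable_of_tendsto_ae atTop
      (f := fun (n : ℕ) a => (((n + N : ℕ) : ℂ) + 1) •
        (H a (x + (((n + N : ℕ) : ℂ) + 1)⁻¹ • h) - H a x)) (fun n => ?_) ?_
    · exact ((hm _ (hN _ (Nat.le_add_left _ _))).sub (hm x hxr)).const_mul (((n + N : ℕ) : ℂ) + 1)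
    · filter_upwards [hd] with a hda
      have hx : DifferentiableAt ℂ (H a) x := hda.differentiableAt (Metric.ball_mem_nhds x hr)
      have hne : ∀ n : ℕ, ((n : ℂ) + 1) ≠ 0 := fun n => by exact_mod_cast n.succ_ne_zero
      have key := hx.hasFDerivAt.lim h (c := fun n : ℕ => (n : ℂ) + 1) (l := atTop) ?_
      · exact (tendsto_add_atTop_iff_nat N).mpr key
      · exact tendsto_norm_cobounded_atTop.comp
          ((tendsto_add_const_cobounded 1).comp tendsto_natCast_atTop_cobounded)
  have hintL : ∀ h, Integrable (fun a => fderiv ℂ (H a) x h) ν := fun h =>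
    .of_bound (hmeas h) _ (hbd h)
  let L' : E →ₗ[ℂ] ℂ :=
    { toFun := fun h => ∫ a, fderiv ℂ (H a) x h ∂ν
      map_add' := fun h k => by
        simp only [map_add]
        exact integral_add (hintL h) (hintL k)
      map_smul' := fun c h => by
        simp only [map_smul, RingHom.id_apply]
        exact integral_const_mul c _ }
  have hL : ∀ h, ‖L' h‖ ≤ 2 * M / r * ν.real univ * ‖h‖ := fun h =>
    (norm_integral_le_of_norm_le_const (hbd h)).trans_eq (by ring)
  refine (hasFDerivAt_of_taylor (L := L'.mkContinuous _ hL)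
    (C := 4 * M / r ^ 2 * ν.real univ) hr fun y hy => ?_).differentiableAt
  have heq : (∫ a, H a y ∂ν) - (∫ a, H a x ∂ν) - (L'.mkContinuous _ hL) (y - x)
      = ∫ a, (H a y - H a x - fderiv ℂ (H a) x (y - x)) ∂ν := by
    rw [integral_sub (f := fun a => H a y - H a x) ((hint y hy).sub (hint x hxr)) (hintL _),
      integral_sub (hint y hy) (hint x hxr)]
    rfl
  rw [heq]
  refine (norm_integral_le_of_norm_le_const (C := 4 * M / r ^ 2 * ‖y - x‖ ^ 2) ?_).trans_eq
    (by ring)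
  filter_upwards [hd, hM] with a hda hMa
  exact norm_taylor_le_of_norm_le hr hda hMa hy

end Holomorphic

theorem extendZero_of_mem {X : Type*} [NormedAddCommGroup X]
    {f : Metric.ball (0 : X) 1 → ℂ} {z : X}
    (hz : z ∈ Metric.ball (0 : X) 1) : extendZero f z = f ⟨z, hz⟩ :=
  extendZero_coe f ⟨z, hz⟩

/-- A function continuous on an open set is bounded on a uniform neighbourhood of a compact
subset. -/
theorem exists_norm_le_near_compact {X : Type*} [NormedAddCommGroup X] {f : X → ℂ}
    {U K : Set X} (hU : IsOpen U)
    (hf : ContinuousOn f U) (hK : IsCompact K) (hKU : K ⊆ U) :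
    ∃ r > 0, ∃ M, 0 ≤ M ∧ ∀ x ∈ K, ∀ y ∈ Metric.ball x r, y ∈ U ∧ ‖f y‖ ≤ M := by
  obtain ⟨M, hM⟩ := hK.exists_bound_of_continuousOn (hf.mono hKU)
  have hV : IsOpen (U ∩ f ⁻¹' Metric.ball 0 (|M| + 1)) :=
    hf.isOpen_inter_preimage hU Metric.isOpen_ball
  obtain ⟨r, hr, hrV⟩ := hK.exists_thickening_subset_open hV fun x hx =>
    ⟨hKU hx, by simpa using (hM x hx).trans_lt (by linarith [le_abs_self M])⟩
  refine ⟨r, hr, |M| + 1, by positivity, fun x hx y hy => ?_⟩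
  have := hrV (Metric.mem_thickening_iff.mpr ⟨x, hx, hy⟩)
  exact ⟨this.1, le_of_lt (by simpa using this.2)⟩

/-! ### Radial derivatives -/

section Radial

variable {X : Type*} [NormedAddCommGroup X] [NormedSpace ℂ X]

theorem smul_mem_unitBall {z : X} (hz : z ∈ Metric.ball (0 : X) 1) {t : ℝ}
    (ht : t ∈ Icc (0 : ℝ) 1) :
    (t : ℂ) • z ∈ Metric.ball (0 : X) 1 := by
  rw [mem_ball_zero_iff] at *
  rw [norm_smul, Complex.norm_real, Real.norm_of_nonneg ht.1]
  exact (mul_le_of_le_one_left (norm_nonneg _) ht.2).trans_lt hz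

theorem norm_ofReal_smul {t : ℝ} (ht : 0 ≤ t) (z : X) : ‖(t : ℂ) • z‖ = t * ‖z‖ := by
  rw [norm_smul, Complex.norm_real, Real.norm_of_nonneg ht]

theorem radialDeriv_ofReal_smul (φ : Metric.ball (0 : X) 1 → ℂ) (t : ℝ) (z : X) :
    radialDeriv φ ((t : ℂ) • z) = t * fderiv ℂ (extendZero φ) ((t : ℂ) • z) z := by
  rw [radialDeriv, map_smul, smul_eq_mul]

theorem radialDeriv_origin (φ : Metric.ball (0 : X) 1 → ℂ) : radialDeriv φ 0 = 0 := by
  simp [radialDeriv]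

/-- The radial derivative of a holomorphic function is holomorphic. -/
theorem IsHolomorphic.differentiableOn_radialDeriv {φ : Metric.ball (0 : X) 1 → ℂ}
    (hφ : IsHolomorphic φ) : DifferentiableOn ℂ (radialDeriv φ) (Metric.ball (0 : X) 1) := by
  intro x hx
  obtain ⟨r, hr, M, hM0, hM⟩ := exists_norm_le_near_compact Metric.isOpen_ball hφ.continuousOn
    (isCompact_singleton (x := x)) (singleton_subset_iff.mpr hx)
  simp only [mem_singleton_iff, forall_eq] at hM
  have hsub : ∀ y ∈ Metric.ball x (r / 2), Metric.ball y (r / 2) ⊆ Metric.ball x r := by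
    intro y hy
    refine Metric.ball_subset_ball' ?_
    linarith [Metric.mem_ball.mp hy]
  have hd : DifferentiableOn ℂ (extendZero φ) (Metric.ball x r) :=
    hφ.mono fun y hy => (hM y hy).1
  let c : ℕ → ℂ := fun n => (n : ℂ) + 1
  have hc : Tendsto (fun n => ‖c n‖) atTop atTop := tendsto_norm_cobounded_atTop.comp
    ((tendsto_add_const_cobounded 1).comp tendsto_natCast_atTop_cobounded)
  have hU : (hyperfilter ℕ : Filter ℕ) ≤ atTop := Nat.hyperfilter_le_atTop
  have hlarge : ∀ᶠ n in (hyperfilter ℕ : Filter ℕ), ∀ y ∈ Metric.ball x (r / 2),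
      y + (c n)⁻¹ • y ∈ Metric.ball y (r / 2) := by
    filter_upwards [hU (hc.eventually_gt_atTop (2 / r))] with n hn y hy
    have hy1 : ‖y‖ < 1 := by
      simpa using (hM y (Metric.ball_subset_ball (by linarith) hy)).1
    have hcn : 0 < ‖c n‖ := lt_trans (by positivity) hn
    rw [Metric.mem_ball, dist_eq_norm, add_sub_cancel_left, norm_smul, norm_inv]
    have : ‖c n‖⁻¹ < r / 2 := by
      rw [inv_lt_comm₀ hcn (by positivity), inv_div]
      exact hn
    nlinarith [norm_nonneg y, inv_pos.mpr hcn]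
  -- The difference quotients `c (φ(y + y/c) - φ(y))` are holomorphic, uniformly bounded near `x`,
  -- and converge pointwise to `ℛφ`.
  have key := exists_hasFDerivAt_of_tendsto (U := hyperfilter ℕ) (x := x) (r := r / 2)
    (M := 4 * M / r) (f := radialDeriv φ)
    (F := fun n y => c n • (extendZero φ (y + (c n)⁻¹ • y) - extendZero φ y)) (by positivity)
    ?_ ?_ ?_
  · obtain ⟨L, hL, -⟩ := key
    exact hL.differentiableAt.differentiableWithinAt
  · filter_upwards [hlarge] with n hn
    have h1 : DifferentiableOn ℂ (fun y => extendZero φ (y + (c n)⁻¹ • y))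
        (Metric.ball x (r / 2)) :=
      hd.comp (by fun_prop) fun y hy => hsub y hy (hn y hy)
    exact (h1.sub (hd.mono (Metric.ball_subset_ball (by linarith)))).const_smul (c n)
  · filter_upwards [hlarge, hU (hc.eventually_gt_atTop 0)] with n hn hn0 y hy
    have hy1 : ‖y‖ < 1 := by
      simpa using (hM y (Metric.ball_subset_ball (by linarith) hy)).1
    have := norm_sub_le_of_norm_le (by positivity) (hd.mono (hsub y hy))
      (fun w hw => (hM w (hsub y hy hw)).2) (hn y hy)
    rw [add_sub_cancel_left, norm_smul, norm_inv] at this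
    rw [norm_smul]
    calc ‖c n‖ * ‖extendZero φ (y + (c n)⁻¹ • y) - extendZero φ y‖
        ≤ ‖c n‖ * (2 * M / (r / 2) * (‖c n‖⁻¹ * ‖y‖)) := by gcongr
      _ = 4 * M / r * ‖y‖ := by ring_nf; field_simp
      _ ≤ 4 * M / r := mul_le_of_le_one_right (by positivity) hy1.le
  · intro y hy
    have hyr := (hM y (Metric.ball_subset_ball (by linarith) hy)).1
    exact ((hφ.differentiableAt hyr).hasFDerivAt.lim y hc).mono_left hU

end Radial

/-! ### The Cesàro operator and its radial derivative -/

section Cesaro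

variable {X : Type*} [NormedAddCommGroup X] [NormedSpace ℂ X]

/-- The integrand in the definition of the extended Cesàro operator. -/
def cesaroIntegrand (φ f : Metric.ball (0 : X) 1 → ℂ) (t : ℝ) (z : X) : ℂ :=
  extendZero f ((t : ℂ) • z) * radialDeriv φ ((t : ℂ) • z) * (1 / (t : ℂ))

theorem cesaro_eq (φ f : Metric.ball (0 : X) 1 → ℂ) (z : Metric.ball (0 : X) 1) :
    cesaro φ f z = ∫ t in Ioc (0 : ℝ) 1, cesaroIntegrand φ f t z :=
  intervalIntegral.integral_of_le zero_le_one

variable {φ f : Metric.ball (0 : X) 1 → ℂ}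

/-- The singularity at `t = 0` is only apparent: `ℛφ(ty)/t = Dφ(ty) y`. Compactness of the segment
from `0` to `x`, with a Cauchy estimate, makes the bound uniform in `t` and local in `y`. -/
theorem exists_bound_cesaroIntegrand (hφ : IsHolomorphic φ) (hf : IsHolomorphic f) {x : X}
    (hx : x ∈ Metric.ball (0 : X) 1) :
    ∃ r > 0, ∃ M, ∀ y ∈ Metric.ball x r, y ∈ Metric.ball (0 : X) 1 ∧
      ∀ t ∈ Ioc (0 : ℝ) 1, ‖cesaroIntegrand φ f t y‖ ≤ M := by
  have hK : IsCompact ((fun t : ℝ => (t : ℂ) • x) '' Icc 0 1) :=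
    isCompact_Icc.image (by fun_prop)
  have hKB : (fun t : ℝ => (t : ℂ) • x) '' Icc 0 1 ⊆ Metric.ball (0 : X) 1 := by
    rintro _ ⟨t, ht, rfl⟩
    exact smul_mem_unitBall hx ht
  obtain ⟨r, hr, M, hM0, hM⟩ :=
    exists_norm_le_near_compact Metric.isOpen_ball hφ.continuousOn hK hKB
  obtain ⟨s, hs, N, hN0, hN⟩ :=
    exists_norm_le_near_compact Metric.isOpen_ball hf.continuousOn hK hKB
  simp only [forall_mem_image] at hM hN
  have hmin : 0 < min (r / 2) s := by positivity
  refine ⟨min (r / 2) s, hmin, N * (2 * M / (r / 2)), fun y hy => ?_⟩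
  have hyr : y ∈ Metric.ball x (r / 2) := Metric.ball_subset_ball (min_le_left _ _) hy
  have hys : y ∈ Metric.ball x s := Metric.ball_subset_ball (min_le_right _ _) hy
  have hy1 : y ∈ Metric.ball (0 : X) 1 := by
    refine (hM (x := 1) ⟨zero_le_one, le_rfl⟩ y ?_).1
    simpa using Metric.ball_subset_ball (by linarith) hyr
  refine ⟨hy1, fun t ht => ?_⟩
  have hdist : ‖(t : ℂ) • y - (t : ℂ) • x‖ ≤ ‖y - x‖ := by
    rw [← smul_sub, norm_ofReal_smul ht.1.le]
    exact mul_le_of_le_one_left (norm_nonneg _) ht.2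
  rw [Metric.mem_ball, dist_eq_norm] at hyr hys
  have hft := (hN ⟨ht.1.le, ht.2⟩ ((t : ℂ) • y)
    (by rw [Metric.mem_ball, dist_eq_norm]; linarith)).2
  have hsub : Metric.ball ((t : ℂ) • y) (r / 2) ⊆ Metric.ball ((t : ℂ) • x) r := by
    refine Metric.ball_subset_ball' ?_
    rw [dist_eq_norm]
    linarith
  have hφt : ‖fderiv ℂ (extendZero φ) ((t : ℂ) • y)‖ ≤ 2 * M / (r / 2) :=
    norm_fderiv_le_of_norm_le (by positivity)
      (hφ.mono fun w hw => (hM ⟨ht.1.le, ht.2⟩ w (hsub hw)).1)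
      fun w hw => (hM ⟨ht.1.le, ht.2⟩ w (hsub hw)).2
  have hval : cesaroIntegrand φ f t y
      = extendZero f ((t : ℂ) • y) * fderiv ℂ (extendZero φ) ((t : ℂ) • y) y := by
    have : (t : ℂ) ≠ 0 := by exact_mod_cast ht.1.ne'
    rw [cesaroIntegrand, radialDeriv_ofReal_smul]
    field_simp
  rw [hval, norm_mul]
  refine mul_le_mul hft ?_ (norm_nonneg _) hN0
  exact ((fderiv ℂ (extendZero φ) ((t : ℂ) • y)).le_of_opNorm_le hφt y).trans
    (mul_le_of_le_one_right (by positivity) (by simpa using (mem_ball_zero_iff.mp hy1).le))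

theorem continuousOn_cesaroIntegrand (hφ : IsHolomorphic φ) (hf : IsHolomorphic f) (z : X) :
    ContinuousOn (cesaroIntegrand φ f · z)
      (Ioi 0 ∩ (fun t : ℝ => (t : ℂ) • z) ⁻¹' Metric.ball 0 1) := by
  have hsm : ContinuousOn (fun t : ℝ => (t : ℂ) • z)
      (Ioi 0 ∩ (fun t : ℝ => (t : ℂ) • z) ⁻¹' Metric.ball 0 1) := by fun_prop
  refine ((hf.continuousOn.comp hsm fun t ht => ht.2).mul
    (hφ.differentiableOn_radialDeriv.continuousOn.comp hsm fun t ht => ht.2)).mul ?_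
  refine continuousOn_const.div (by fun_prop) fun t ht => ?_
  exact_mod_cast (ne_of_gt ht.1 : t ≠ 0)

theorem aestronglyMeasurable_cesaroIntegrand (hφ : IsHolomorphic φ) (hf : IsHolomorphic f)
    {z : X} (hz : z ∈ Metric.ball (0 : X) 1) :
    AEStronglyMeasurable (cesaroIntegrand φ f · z) (volume.restrict (Ioc 0 1)) :=
  ((continuousOn_cesaroIntegrand hφ hf z).mono fun _ ht =>
    ⟨ht.1, smul_mem_unitBall hz ⟨ht.1.le, ht.2⟩⟩).aestronglyMeasurable measurableSet_Ioc

theorem integrableOn_cesaroIntegrand (hφ : IsHolomorphic φ) (hf : IsHolomorphic f)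
    {z : X} (hz : z ∈ Metric.ball (0 : X) 1) :
    IntegrableOn (cesaroIntegrand φ f · z) (Ioc 0 1) := by
  obtain ⟨r, hr, M, hM⟩ := exists_bound_cesaroIntegrand hφ hf hz
  refine Integrable.of_bound (aestronglyMeasurable_cesaroIntegrand hφ hf hz) M ?_
  filter_upwards [ae_restrict_mem measurableSet_Ioc] with t ht
  exact (hM z (Metric.mem_ball_self hr)).2 t ht

/-- `T_φ f` is holomorphic. -/
theorem isHolomorphic_cesaro (hφ : IsHolomorphic φ) (hf : IsHolomorphic f) :
    IsHolomorphic (cesaro φ f) := by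
  intro x hx
  obtain ⟨r, hr, M, hM⟩ := exists_bound_cesaroIntegrand hφ hf hx
  have hdiff := differentiableAt_integral (ν := volume.restrict (Ioc (0 : ℝ) 1))
    (H := cesaroIntegrand φ f) (M := M) hr ?_ ?_
    (fun y hy => aestronglyMeasurable_cesaroIntegrand hφ hf (hM y hy).1)
  · refine (hdiff.congr_of_eventuallyEq ?_).differentiableWithinAt
    filter_upwards [Metric.isOpen_ball.mem_nhds hx] with y hy
    rw [extendZero_of_mem hy, cesaro_eq]
  · filter_upwards [ae_restrict_mem measurableSet_Ioc] with t ht y hy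
    have hty := smul_mem_unitBall (hM y hy).1 ⟨ht.1.le, ht.2⟩
    refine DifferentiableAt.differentiableWithinAt ?_
    refine DifferentiableAt.mul_const (DifferentiableAt.mul ?_ ?_) _
    · exact (hf.differentiableAt hty).comp y (by fun_prop)
    · exact (hφ.differentiableOn_radialDeriv.differentiableAt
        (Metric.isOpen_ball.mem_nhds hty)).comp y (by fun_prop)
  · filter_upwards [ae_restrict_mem measurableSet_Ioc] with t ht y hy
    exact (hM y hy).2 t ht

theorem hasDerivAt_extendZero_smul (hf : IsHolomorphic f) {z : X} {t : ℝ}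
    (ht : (t : ℂ) • z ∈ Metric.ball (0 : X) 1) :
    HasDerivAt (fun s : ℝ => extendZero f ((s : ℂ) • z))
      (fderiv ℂ (extendZero f) ((t : ℂ) • z) z) t := by
  have h1 : HasDerivAt (fun c : ℂ => c • z) z (t : ℂ) := by
    simpa using (hasDerivAt_id (t : ℂ)).smul_const z
  exact ((hf.differentiableAt ht).hasFDerivAt.comp_hasDerivAt (t : ℂ) h1).comp_ofReal

/-- The measure `dt/t` is dilation invariant, so moving the point along its ray only moves the
endpoint of integration. The radial derivative then follows from the fundamental theorem of calculus
at `s = 1`. -/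
theorem extendZero_cesaro_smul {z : X} {s : ℝ} (hs : 0 < s)
    (hsz : (s : ℂ) • z ∈ Metric.ball (0 : X) 1) :
    extendZero (cesaro φ f) ((s : ℂ) • z) = ∫ u in (0 : ℝ)..s, cesaroIntegrand φ f u z := by
  have h := intervalIntegral.smul_integral_comp_mul_right (a := 0) (b := 1)
    (fun u => cesaroIntegrand φ f u z) s
  rw [zero_mul, one_mul] at h
  rw [extendZero_of_mem hsz, cesaro, ← h, ← intervalIntegral.integral_smul]
  congr 1 with t
  have hs' : (s : ℂ) ≠ 0 := by exact_mod_cast hs.ne'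
  simp only [cesaroIntegrand, smul_smul, Complex.ofReal_mul, Complex.real_smul]
  -- At `t = 0` both sides vanish because `1 / 0 = 0`.
  rcases eq_or_ne (t : ℂ) 0 with h0 | h0
  · simp [h0]
  · field_simp

/-- `ℛ(T_φ f) = f ℛφ`. -/
theorem radialDeriv_cesaro (hφ : IsHolomorphic φ) (hf : IsHolomorphic f) {z : X}
    (hz : z ∈ Metric.ball (0 : X) 1) :
    radialDeriv (cesaro φ f) z = extendZero f z * radialDeriv φ z := by
  have hopen : IsOpen (Ioi 0 ∩ (fun t : ℝ => (t : ℂ) • z) ⁻¹' Metric.ball 0 1) :=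
    isOpen_Ioi.inter (Metric.isOpen_ball.preimage (by fun_prop))
  have h1mem : (1 : ℝ) ∈ Ioi 0 ∩ (fun t : ℝ => (t : ℂ) • z) ⁻¹' Metric.ball 0 1 :=
    ⟨one_pos (α := ℝ), by simpa using hz⟩
  have hcont := continuousOn_cesaroIntegrand hφ hf z
  have hI : HasDerivAt (fun s => ∫ u in (0 : ℝ)..s, cesaroIntegrand φ f u z)
      (cesaroIntegrand φ f 1 z) 1 :=
    intervalIntegral.integral_hasDerivAt_right
      ((intervalIntegrable_iff_integrableOn_Ioc_of_le zero_le_one).mpr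
        (integrableOn_cesaroIntegrand hφ hf hz))
      (hcont.stronglyMeasurableAtFilter hopen 1 h1mem)
      (hcont.continuousAt (hopen.mem_nhds h1mem))
  have hC := hasDerivAt_extendZero_smul (isHolomorphic_cesaro hφ hf) (z := z) (t := 1)
    (by simpa using hz)
  have heq : (fun s : ℝ => extendZero (cesaro φ f) ((s : ℂ) • z)) =ᶠ[𝓝 1]
      fun s => ∫ u in (0 : ℝ)..s, cesaroIntegrand φ f u z := by
    filter_upwards [hopen.mem_nhds h1mem] with s hs
    exact extendZero_cesaro_smul hs.1 hs.2
  have := hC.unique (hI.congr_of_eventuallyEq heq)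
  simpa [cesaroIntegrand, radialDeriv] using this

theorem weighted_cesaro (μ : NormalFunction) (hφ : IsHolomorphic φ) (hf : IsHolomorphic f)
    (z : Metric.ball (0 : X) 1) :
    weighted μ (cesaro φ f) z = weighted μ φ z * ‖f z‖ := by
  rw [weighted, weighted, radialDeriv_cesaro hφ hf z.2, extendZero_coe, norm_mul]
  ring

theorem cesaro_origin (φ f : Metric.ball (0 : X) 1 → ℂ) : cesaro φ f BlochSpace.origin = 0 := by
  simp [cesaro, BlochSpace.origin, radialDeriv_origin]

theorem cesaro_add {g : Metric.ball (0 : X) 1 → ℂ} (hφ : IsHolomorphic φ) (hf : IsHolomorphic f)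
    (hg : IsHolomorphic g) : cesaro φ (f + g) = cesaro φ f + cesaro φ g := by
  funext z
  rw [Pi.add_apply, cesaro_eq, cesaro_eq, cesaro_eq, ← integral_add
    (integrableOn_cesaroIntegrand hφ hf z.2) (integrableOn_cesaroIntegrand hφ hg z.2)]
  simp only [cesaroIntegrand, extendZero_add, Pi.add_apply, add_mul]

theorem cesaro_smul (c : ℂ) (φ f : Metric.ball (0 : X) 1 → ℂ) :
    cesaro φ (c • f) = c • cesaro φ f := by
  funext z
  rw [Pi.smul_apply, cesaro_eq, cesaro_eq, smul_eq_mul, ← integral_const_mul]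
  simp only [cesaroIntegrand, extendZero_smul, Pi.smul_apply, smul_eq_mul, mul_assoc]

end Cesaro

/-! ### The primitive of the reciprocal weight -/

section Weight

variable (ω : NormalFunction)

theorem NormalFunction.continuousOn_one_div : ContinuousOn (fun t => 1 / ω t) (Ico 0 1) :=
  continuousOn_const.div ω.continuousOn fun t ht => (ω.pos t ht).ne'

theorem NormalFunction.intervalIntegrable_one_div {a b : ℝ} (ha : a ∈ Ico (0 : ℝ) 1)
    (hb : b ∈ Ico (0 : ℝ) 1) : IntervalIntegrable (fun t => 1 / ω t) volume a b :=
  (ω.continuousOn_one_div.mono (ordConnected_Ico.uIcc_subset ha hb)).intervalIntegrable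

/-- The primitive `∫₀ʳ dt / ω(t)` of the reciprocal weight. -/
def NormalFunction.primitive (r : ℝ) : ℝ := ∫ t in (0 : ℝ)..r, 1 / ω t

theorem NormalFunction.primitive_sub {a b : ℝ} (ha : a ∈ Ico (0 : ℝ) 1) (hb : b ∈ Ico (0 : ℝ) 1) :
    ω.primitive b - ω.primitive a = ∫ t in a..b, 1 / ω t :=
  intervalIntegral.integral_interval_sub_left
    (ω.intervalIntegrable_one_div ⟨le_rfl, one_pos⟩ hb)
    (ω.intervalIntegrable_one_div ⟨le_rfl, one_pos⟩ ha)

theorem NormalFunction.monotoneOn_primitive : MonotoneOn ω.primitive (Ico 0 1) := by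
  intro a ha b hb hab
  rw [← sub_nonneg, ω.primitive_sub ha hb]
  exact intervalIntegral.integral_nonneg hab fun t ht =>
    (one_div_pos.mpr (ω.pos t ⟨ha.1.trans ht.1, ht.2.trans_lt hb.2⟩)).le

theorem NormalFunction.primitive_nonneg {r : ℝ} (hr : r ∈ Ico (0 : ℝ) 1) : 0 ≤ ω.primitive r := by
  have := ω.monotoneOn_primitive ⟨le_rfl, one_pos⟩ hr hr.1
  simpa [primitive] using this

theorem NormalFunction.hasDerivAt_primitive {r : ℝ} (hr : r ∈ Ioo (0 : ℝ) 1) :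
    HasDerivAt ω.primitive (1 / ω r) r := by
  have hcont : ContinuousOn (fun t => 1 / ω t) (Ioo 0 1) :=
    ω.continuousOn_one_div.mono Ioo_subset_Ico_self
  exact intervalIntegral.integral_hasDerivAt_right
    (ω.intervalIntegrable_one_div ⟨le_rfl, one_pos⟩ ⟨hr.1.le, hr.2⟩)
    (hcont.stronglyMeasurableAtFilter isOpen_Ioo r hr)
    (hcont.continuousAt (isOpen_Ioo.mem_nhds hr))

/-- The growth function `1 + 1 / ω(1/2) + 2 ∫₀ʳ dt / ω(t)` of the Bloch-type space. -/
def NormalFunction.growth (r : ℝ) : ℝ := 1 + 1 / ω (1 / 2) + 2 * ω.primitive r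

theorem NormalFunction.half_pos : 0 < ω (1 / 2) := ω.pos _ ⟨by norm_num, by norm_num⟩

theorem NormalFunction.growth_pos {r : ℝ} (hr : r ∈ Ico (0 : ℝ) 1) : 0 < ω.growth r := by
  have := ω.primitive_nonneg hr
  have := ω.half_pos
  unfold growth
  positivity

theorem NormalFunction.growth_mono {r s : ℝ} (hr : r ∈ Ico (0 : ℝ) 1) (hs : s ∈ Ico (0 : ℝ) 1)
    (h : r ≤ s) : ω.growth r ≤ ω.growth s := by
  have := ω.monotoneOn_primitive hr hs h
  unfold growth
  linarith

end Weight

/-! ### Growth estimates and compactness for pointwise convergence -/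

section Growth

variable {X : Type*} [NormedAddCommGroup X] [NormedSpace ℂ X] {ω : NormalFunction}
  {f : Metric.ball (0 : X) 1 → ℂ} {M : ℝ}

theorem norm_radialDeriv_le (hM : ∀ z, weighted ω f z ≤ M) {z : X}
    (hz : z ∈ Metric.ball (0 : X) 1) : ‖radialDeriv f z‖ ≤ M / ω ‖z‖ := by
  rw [le_div_iff₀' (ω.pos_norm ⟨z, hz⟩)]
  exact hM ⟨z, hz⟩

/-- Along the ray the derivative is `ℛf(tw)/t`, of size at most `M / (t ω(t‖w‖))`. Since `t‖w‖ ≥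
1/2`, this is at most `2M‖w‖ / ω(t‖w‖)`, the derivative of `2M ω.primitive (t‖w‖)`. -/
theorem norm_sub_smul_le (hf : IsHolomorphic f) (hM : ∀ z, weighted ω f z ≤ M) {w : X}
    (hw : w ∈ Metric.ball (0 : X) 1) {θ : ℝ} (hθ0 : 0 < θ) (hθ1 : θ ≤ 1)
    (hθ : 1 / 2 ≤ θ * ‖w‖) :
    ‖extendZero f w - extendZero f ((θ : ℂ) • w)‖ ≤
      2 * M * (ω.primitive ‖w‖ - ω.primitive (θ * ‖w‖)) := by
  have hw1 : ‖w‖ < 1 := by simpa using hw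
  have hM0 : 0 ≤ M := (weighted_nonneg ω f ⟨w, hw⟩).trans (hM _)
  have hmem : ∀ t ∈ Icc θ 1, (t : ℂ) • w ∈ Metric.ball (0 : X) 1 := fun t ht =>
    smul_mem_unitBall hw ⟨hθ0.le.trans ht.1, ht.2⟩
  have hw0 : 0 < ‖w‖ := by
    by_contra h
    have : ‖w‖ = 0 := le_antisymm (not_lt.mp h) (norm_nonneg _)
    rw [this] at hθ
    norm_num at hθ
  have htw : ∀ t ∈ Icc θ 1, 1 / 2 ≤ t * ‖w‖ ∧ t * ‖w‖ < 1 := fun t ht =>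
    ⟨hθ.trans (by gcongr; exact ht.1), by nlinarith [ht.2]⟩
  have hd : ∀ t ∈ Icc θ 1, HasDerivAt
      (fun t : ℝ => extendZero f ((t : ℂ) • w) - extendZero f ((θ : ℂ) • w))
      (fderiv ℂ (extendZero f) ((t : ℂ) • w) w) t := fun t ht =>
    (hasDerivAt_extendZero_smul hf (hmem t ht)).sub_const _
  have hB : ∀ t ∈ Icc θ 1, HasDerivAt
      (fun t : ℝ => 2 * M * (ω.primitive (t * ‖w‖) - ω.primitive (θ * ‖w‖)))
      (2 * M * (1 / ω (t * ‖w‖) * ‖w‖)) t := by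
    intro t ht
    have h1 : HasDerivAt (fun t : ℝ => t * ‖w‖) ‖w‖ t := hasDerivAt_mul_const ‖w‖
    have h2 := ω.hasDerivAt_primitive (r := t * ‖w‖)
      ⟨by linarith [(htw t ht).1], (htw t ht).2⟩
    exact ((h2.comp t h1).sub_const _).const_mul _
  have := image_norm_le_of_norm_deriv_right_le_deriv_boundary' (a := θ) (b := 1)
    (fun t ht => (hd t ht).continuousAt.continuousWithinAt)
    (fun t ht => (hd t ⟨ht.1, ht.2.le⟩).hasDerivWithinAt)
    (B := fun t : ℝ => 2 * M * (ω.primitive (t * ‖w‖) - ω.primitive (θ * ‖w‖)))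
    (by simp) (fun t ht => (hB t ht).continuousAt.continuousWithinAt)
    (fun t ht => (hB t ⟨ht.1, ht.2.le⟩).hasDerivWithinAt) ?_ ⟨hθ1, le_rfl⟩
  · simpa using this
  · intro t ht
    have ht' : t ∈ Icc θ 1 := ⟨ht.1, ht.2.le⟩
    have ht0 : 0 < t := hθ0.trans_le ht.1
    have h1 := norm_radialDeriv_le hM (hmem t ht')
    rw [radialDeriv_ofReal_smul, norm_mul, Complex.norm_real, Real.norm_of_nonneg ht0.le,
      norm_ofReal_smul ht0.le] at h1
    have hpos : 0 < ω (t * ‖w‖) := ω.pos _ ⟨by linarith [(htw t ht').1], (htw t ht').2⟩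
    refine le_of_mul_le_mul_left (h1.trans ?_) ht0
    have : t * (2 * M * (1 / ω (t * ‖w‖) * ‖w‖)) = M / ω (t * ‖w‖) * (2 * (t * ‖w‖)) := by
      field_simp
    rw [this]
    refine le_mul_of_one_le_right (by positivity) ?_
    linarith [(htw t ht').1]

/-- The radial bound degenerates like `1/t` at the origin, so the maximum principle is used on the
slice `c ↦ f(cw)`: its derivative is controlled on the circle where `‖cw‖ = 1/2`, hence on the whole
disc, which contains `0` and `1`. -/
theorem norm_sub_origin_le_of_norm_le_half (hf : IsHolomorphic f) (hM : ∀ z, weighted ω f z ≤ M)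
    {w : X} (hw : ‖w‖ ≤ 1 / 2) : ‖extendZero f w - extendZero f 0‖ ≤ M / ω (1 / 2) := by
  have hM0 : 0 ≤ M := (weighted_nonneg ω f BlochSpace.origin).trans (hM _)
  have hω := ω.half_pos
  rcases eq_or_ne w 0 with rfl | hw0
  · simp only [sub_self, norm_zero]
    positivity
  have hwp : 0 < ‖w‖ := norm_pos_iff.mpr hw0
  set R : ℝ := 1 / (2 * ‖w‖) with hR
  have hRw : R * ‖w‖ = 1 / 2 := by rw [hR]; field_simp
  have hR1 : 1 ≤ R := by rw [hR, le_div_iff₀ (by positivity)]; linarith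
  have hmem : ∀ c ∈ Metric.ball (0 : ℂ) (2 * R), c • w ∈ Metric.ball (0 : X) 1 := by
    intro c hc
    rw [mem_ball_zero_iff] at hc ⊢
    rw [norm_smul]
    nlinarith
  have hp : ∀ c ∈ Metric.ball (0 : ℂ) (2 * R), HasDerivAt (fun c : ℂ => extendZero f (c • w))
      (fderiv ℂ (extendZero f) (c • w) w) c := by
    intro c hc
    have h1 : HasDerivAt (fun c : ℂ => c • w) w c := by
      simpa using (hasDerivAt_id c).smul_const w
    exact (hf.differentiableAt (hmem c hc)).hasFDerivAt.comp_hasDerivAt c h1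
  have hsub : Metric.closedBall (0 : ℂ) R ⊆ Metric.ball 0 (2 * R) :=
    Metric.closedBall_subset_ball (by linarith)
  have hpd : DifferentiableOn ℂ (deriv fun c : ℂ => extendZero f (c • w))
      (Metric.ball (0 : ℂ) (2 * R)) :=
    DifferentiableOn.deriv (fun c hc => (hp c hc).differentiableAt.differentiableWithinAt)
      Metric.isOpen_ball
  have hbound : ∀ c ∈ Metric.closedBall (0 : ℂ) R,
      ‖deriv (fun c : ℂ => extendZero f (c • w)) c‖ ≤ M / ω (1 / 2) := by
    intro c hc
    refine Complex.norm_le_of_forall_mem_frontier_norm_le (U := Metric.ball (0 : ℂ) R)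
      Metric.isBounded_ball (DifferentiableOn.diffContOnCl ?_) ?_ ?_
    · rw [closure_ball _ (by linarith)]
      exact hpd.mono hsub
    · rw [frontier_ball _ (by linarith)]
      intro d hd
      have hdR : ‖d‖ = R := by simpa using hd
      have hd2 := hsub (Metric.sphere_subset_closedBall hd)
      rw [(hp d hd2).deriv]
      have h1 := norm_radialDeriv_le hM (hmem d hd2)
      rw [radialDeriv, map_smul, norm_smul, norm_smul, hdR, hRw] at h1
      exact (le_mul_of_one_le_left (norm_nonneg _) hR1).trans h1
    · rwa [closure_ball _ (by linarith)]
  have hone : (1 : ℂ) ∈ Metric.closedBall (0 : ℂ) R := by simpa using hR1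
  have hzero : (0 : ℂ) ∈ Metric.closedBall (0 : ℂ) R := by simpa using by linarith
  simpa using Convex.norm_image_sub_le_of_norm_deriv_le
    (fun c hc => (hp c (hsub hc)).differentiableAt) hbound (convex_closedBall 0 R) hzero hone

/-- The growth estimate for Bloch-type functions. -/
theorem norm_sub_origin_le (hf : IsHolomorphic f) (hM : ∀ z, weighted ω f z ≤ M) {w : X}
    (hw : w ∈ Metric.ball (0 : X) 1) :
    ‖extendZero f w - extendZero f 0‖ ≤ M * (1 / ω (1 / 2) + 2 * ω.primitive ‖w‖) := by
  have hM0 : 0 ≤ M := (weighted_nonneg ω f BlochSpace.origin).trans (hM _)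
  have hw1 : ‖w‖ < 1 := by simpa using hw
  have hW := ω.primitive_nonneg ⟨norm_nonneg w, hw1⟩
  rcases le_total ‖w‖ (1 / 2) with h | h
  · refine (norm_sub_origin_le_of_norm_le_half hf hM h).trans ?_
    rw [mul_add, mul_one_div]
    exact le_add_of_nonneg_right (by positivity)
  · have hwp : 0 < ‖w‖ := by linarith
    -- `θ • w` is where the ray through `w` crosses the sphere of radius `1/2`.
    set θ : ℝ := 1 / (2 * ‖w‖)
    have hθ : θ * ‖w‖ = 1 / 2 := by simp only [θ]; field_simp
    have hθ0 : 0 < θ := by positivity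
    have hθ1 : θ ≤ 1 := by
      simp only [θ]
      rw [div_le_one (by positivity)]
      linarith
    have h1 := norm_sub_smul_le hf hM hw hθ0 hθ1 hθ.ge
    have h2 := norm_sub_origin_le_of_norm_le_half hf hM (w := (θ : ℂ) • w)
      (by rw [norm_ofReal_smul hθ0.le, hθ])
    rw [hθ] at h1
    have h3 := ω.primitive_nonneg (r := 1 / 2) ⟨by norm_num, by norm_num⟩
    have h4 := norm_sub_le_norm_sub_add_norm_sub (extendZero f w)
      (extendZero f ((θ : ℂ) • w)) (extendZero f 0)
    have h5 : M / ω (1 / 2) = M * (1 / ω (1 / 2)) := by ring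
    nlinarith

namespace BlochSpace

variable (g : BlochSpace X ω)

theorem weighted_le_norm (z : Metric.ball (0 : X) 1) : weighted ω g z ≤ ‖g‖ := by
  have := le_ciSup g.mem.2 z
  rw [norm_def]
  linarith [norm_nonneg (g origin)]

theorem norm_le_of_forall {C : ℝ} (h : ∀ z, ‖g origin‖ + weighted ω g z ≤ C) : ‖g‖ ≤ C := by
  have : Nonempty (Metric.ball (0 : X) 1) := ⟨origin⟩
  have : (⨆ z, weighted ω g z) ≤ C - ‖g origin‖ := ciSup_le fun z => by linarith [h z]
  rw [norm_def]
  linarith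

theorem origin_add_weighted_le_norm (z : Metric.ball (0 : X) 1) :
    ‖g origin‖ + weighted ω g z ≤ ‖g‖ := by
  rw [norm_def]
  gcongr
  exact le_ciSup g.mem.2 z

theorem norm_apply_le {z : X} (hz : z ∈ Metric.ball (0 : X) 1) :
    ‖extendZero g z‖ ≤ ‖g‖ * ω.growth ‖z‖ := by
  have h1 := norm_sub_origin_le g.mem.1 g.weighted_le_norm hz
  have h2 : ‖extendZero g 0‖ ≤ ‖g‖ := by
    have := g.origin_add_weighted_le_norm origin
    rw [show extendZero g 0 = g origin from extendZero_coe _ origin]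
    linarith [weighted_nonneg ω g origin]
  have h3 := norm_le_norm_add_norm_sub' (extendZero g z) (extendZero g 0)
  rw [NormalFunction.growth, add_assoc, mul_add, mul_one]
  linarith

theorem extendZero_sub (g h : BlochSpace X ω) (z : X) :
    extendZero (⇑(g - h)) z = extendZero g z - extendZero h z := by
  by_cases hz : z ∈ Metric.ball (0 : X) 1
  · rw [extendZero_of_mem hz, extendZero_of_mem hz, extendZero_of_mem hz]
    rfl
  · simp [extendZero, mem_ball_zero_iff.not.mp hz]

/-- Functions in a bounded subset of a Bloch-type space are locally uniformly bounded. -/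
theorem exists_ball_norm_le {x : X} (hx : x ∈ Metric.ball (0 : X) 1) :
    ∃ r > 0, Metric.ball x r ⊆ Metric.ball (0 : X) 1 ∧ ∃ M, 0 ≤ M ∧
      ∀ g : BlochSpace X ω, ∀ y ∈ Metric.ball x r, ‖extendZero g y‖ ≤ ‖g‖ * M := by
  have hx1 : ‖x‖ < 1 := by simpa using hx
  have hρ : (1 + ‖x‖) / 2 ∈ Ico (0 : ℝ) 1 := ⟨by positivity, by linarith⟩
  have hy : ∀ y ∈ Metric.ball x ((1 - ‖x‖) / 2), ‖y‖ < (1 + ‖x‖) / 2 := by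
    intro y hy
    have := norm_le_norm_add_norm_sub' y x
    rw [Metric.mem_ball, dist_eq_norm] at hy
    linarith
  have hsub : Metric.ball x ((1 - ‖x‖) / 2) ⊆ Metric.ball (0 : X) 1 := fun y h =>
    mem_ball_zero_iff.mpr ((hy y h).trans hρ.2)
  refine ⟨(1 - ‖x‖) / 2, by linarith, hsub, ω.growth ((1 + ‖x‖) / 2), (ω.growth_pos hρ).le,
    fun g y h => (g.norm_apply_le (hsub h)).trans ?_⟩
  gcongr
  exact ω.growth_mono ⟨norm_nonneg y, (hy y h).trans hρ.2⟩ hρ (hy y h).le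

/-- The closed unit ball of a Bloch-type space is compact for pointwise convergence. -/
theorem exists_tendsto_of_ultrafilter (U : Ultrafilter (BlochSpace X ω))
    (hU : ∀ᶠ g in (U : Filter (BlochSpace X ω)), ‖g‖ ≤ 1) :
    ∃ F : BlochSpace X ω, ‖F‖ ≤ 1 ∧
      ∀ z ∈ Metric.ball (0 : X) 1,
        Tendsto (fun g : BlochSpace X ω => extendZero (⇑g) z) U (𝓝 (extendZero F z)) := by
  have hex : ∀ z : Metric.ball (0 : X) 1, ∃ a : ℂ,
      Tendsto (fun g : BlochSpace X ω => extendZero (⇑g) (z : X)) U (𝓝 a) := by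
    intro z
    obtain ⟨a, -, ha⟩ := Ultrafilter.exists_tendsto_of_norm_le (U := U)
      (u := fun g : BlochSpace X ω => extendZero (⇑g) (z : X)) (M := ω.growth ‖(z : X)‖) (by
        filter_upwards [hU] with g hg
        refine (g.norm_apply_le z.2).trans (mul_le_of_le_one_left ?_ hg)
        exact (ω.growth_pos ⟨norm_nonneg _, mem_ball_zero_iff.mp z.2⟩).le)
    exact ⟨a, ha⟩
  choose F hF using hex
  have hF' : ∀ z ∈ Metric.ball (0 : X) 1,
      Tendsto (fun g : BlochSpace X ω => extendZero (⇑g) z) U (𝓝 (extendZero F z)) := by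
    intro z hz
    rw [extendZero_of_mem hz]
    exact hF ⟨z, hz⟩
  have hD : ∀ x ∈ Metric.ball (0 : X) 1, ∃ L : X →L[ℂ] ℂ, HasFDerivAt (extendZero F) L x ∧
      ∀ h, Tendsto (fun g : BlochSpace X ω => fderiv ℂ (extendZero g) x h) U (𝓝 (L h)) := by
    intro x hx
    obtain ⟨r, hr, hsub, M, hM0, hM⟩ := exists_ball_norm_le (ω := ω) hx
    refine exists_hasFDerivAt_of_tendsto (F := fun g : BlochSpace X ω => extendZero (⇑g)) hr
      (.of_forall fun g => g.mem.1.mono hsub) (M := M) ?_ fun y hy => hF' y (hsub hy)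
    filter_upwards [hU] with g hg y hy
    exact (hM g y hy).trans (mul_le_of_le_one_left hM0 hg)
  have hhol : IsHolomorphic F := fun x hx => by
    obtain ⟨L, hL, -⟩ := hD x hx
    exact hL.differentiableAt.differentiableWithinAt
  -- The norm is a supremum of these expressions, and each is a pointwise limit because the
  -- derivatives converge too.
  have hle : ∀ z, ‖F origin‖ + weighted ω F z ≤ 1 := by
    intro z
    obtain ⟨L, hL, hlim⟩ := hD z z.2
    have h1 : Tendsto (fun g : BlochSpace X ω => radialDeriv (⇑g) (z : X)) U
        (𝓝 (radialDeriv F z)) := by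
      rw [radialDeriv, hL.fderiv]
      exact hlim z
    have h2 : Tendsto (fun g : BlochSpace X ω => g origin) U (𝓝 (F origin)) := by
      simpa only [extendZero_coe] using hF origin
    refine le_of_tendsto (h2.norm.add (h1.norm.const_mul (ω ‖(z : X)‖))) ?_
    filter_upwards [hU] with g hg
    exact (g.origin_add_weighted_le_norm z).trans hg
  have hmem : MemBloch ω F := ⟨hhol, 1, by
    rintro _ ⟨z, rfl⟩
    linarith [hle z, norm_nonneg (F origin)]⟩
  exact ⟨⟨F, hmem⟩, norm_le_of_forall _ hle, hF'⟩

/-- Pointwise convergence on the unit ball of a Bloch-type space is uniform on compact sets. -/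
theorem eventually_forall_mem_compact {U : Ultrafilter (BlochSpace X ω)}
    (hU : ∀ᶠ g in (U : Filter (BlochSpace X ω)), ‖g‖ ≤ 1) {F : BlochSpace X ω} (hF : ‖F‖ ≤ 1)
    (hlim : ∀ z ∈ Metric.ball (0 : X) 1,
      Tendsto (fun g : BlochSpace X ω => extendZero (⇑g) z) U (𝓝 (extendZero F z)))
    {K : Set X} (hK : IsCompact K) (hKB : K ⊆ Metric.ball (0 : X) 1) {η : ℝ} (hη : 0 < η) :
    ∀ᶠ g in (U : Filter (BlochSpace X ω)), ∀ x ∈ K, ‖extendZero (⇑(g - F)) x‖ ≤ η := by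
  refine hK.induction_on
    (p := fun s => ∀ᶠ g in (U : Filter (BlochSpace X ω)), ∀ x ∈ s, ‖extendZero (⇑(g - F)) x‖ ≤ η)
    (by simp) (fun s t hst ht => ht.mono fun g hg x hx => hg x (hst hx)) ?_ ?_
  · intro s t hs ht
    filter_upwards [hs, ht] with g hgs hgt x hx
    exact hx.elim (hgs x) (hgt x)
  · intro x hx
    obtain ⟨r, hr, hsub, M, hM0, hM⟩ := exists_ball_norm_le (ω := ω) (hKB hx)
    have hC : 0 < 2 * (2 * M) / r + 1 := by positivity
    -- The functions `g - F` share a Lipschitz bound at `x`; this radius keeps their variation below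
    -- `η / 2`.
    refine ⟨Metric.ball x (min r (η / 2 / (2 * (2 * M) / r + 1))),
      mem_nhdsWithin_of_mem_nhds (Metric.ball_mem_nhds x (by positivity)), ?_⟩
    have hx0 := (tendsto_sub_nhds_zero_iff.mpr (hlim x (hKB hx))).norm
    rw [norm_zero] at hx0
    filter_upwards [hU, hx0.eventually_lt_const (half_pos hη)] with g hg hgx y hy
    have hyr : y ∈ Metric.ball x r := Metric.ball_subset_ball (min_le_left _ _) hy
    have hg2 : ‖g - F‖ ≤ 2 := (norm_sub_le g F).trans (by linarith)
    have h1 := norm_sub_le_of_norm_le hr ((g - F).mem.1.mono hsub) (M := 2 * M)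
      (fun w hw => (hM (g - F) w hw).trans (by gcongr)) hyr
    have h2 : ‖y - x‖ * (2 * (2 * M) / r + 1) ≤ η / 2 := by
      rw [← le_div_iff₀ hC, ← dist_eq_norm]
      exact (Metric.mem_ball.mp hy).le.trans (min_le_right _ _)
    rw [← extendZero_sub] at hgx
    have h3 := norm_le_norm_add_norm_sub' (extendZero (⇑(g - F)) y) (extendZero (⇑(g - F)) x)
    nlinarith [norm_nonneg (y - x)]

end BlochSpace

end Growth

/-! ### A compactness criterion for the Cesàro operator -/

section Compactness

variable {X : Type*} [NormedAddCommGroup X] [NormedSpace ℂ X] {ω μ : NormalFunction}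
  {φ : Metric.ball (0 : X) 1 → ℂ}

/-- `T_φ` as a linear map, when it maps the Bloch-type space of `ω` into that of `μ`. -/
def cesaroLinearMap (hφ : IsHolomorphic φ) (h : ∀ f : BlochSpace X ω, MemBloch μ (cesaro φ f)) :
    BlochSpace X ω →ₗ[ℂ] BlochSpace X μ where
  toFun f := ⟨cesaro φ f, h f⟩
  map_add' f g := Subtype.ext (cesaro_add hφ f.mem.1 g.mem.1)
  map_smul' c f := Subtype.ext (cesaro_smul c φ f)

theorem norm_cesaro_le {g : BlochSpace X μ} {f : BlochSpace X ω} (hφ : IsHolomorphic φ)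
    (hg : ⇑g = cesaro φ f) {C : ℝ} (hC : ∀ z, weighted μ φ z * ‖f z‖ ≤ C) : ‖g‖ ≤ C := by
  refine g.norm_le_of_forall fun z => ?_
  rw [hg, cesaro_origin, weighted_cesaro μ hφ f.mem.1, norm_zero, zero_add]
  exact hC z

/-- If `μ |ℛφ| |f|` is controlled, up to `ε`, by the supremum of `|f|` over a compact subset of the
ball, then `T_φ` is compact. -/
theorem cesaroCompact_of_forall (hφ : IsHolomorphic φ)
    (H : ∀ ε > 0, ∃ K : Set X, IsCompact K ∧ K ⊆ Metric.ball (0 : X) 1 ∧ ∃ A, 0 ≤ A ∧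
      ∀ f : BlochSpace X ω, ‖f‖ ≤ 2 → ∀ s, 0 ≤ s → (∀ x ∈ K, ‖extendZero f x‖ ≤ s) →
        ∀ z, weighted μ φ z * ‖f z‖ ≤ ε + A * s) :
    CesaroCompact ω μ φ := by
  have hmem : ∀ f : BlochSpace X ω, MemBloch μ (cesaro φ f) := by
    have h1 : ∀ f : BlochSpace X ω, ‖f‖ ≤ 2 → MemBloch μ (cesaro φ f) := by
      intro f hf
      obtain ⟨K, hK, hKB, A, -, hA⟩ := H 1 one_pos
      obtain ⟨s, hs⟩ := hK.exists_bound_of_continuousOn (f.mem.1.continuousOn.mono hKB)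
      refine ⟨isHolomorphic_cesaro hφ f.mem.1, 1 + A * |s|, ?_⟩
      rintro _ ⟨z, rfl⟩
      rw [weighted_cesaro μ hφ f.mem.1]
      exact hA f hf |s| (abs_nonneg s) (fun x hx => (hs x hx).trans (le_abs_self s)) z
    intro f
    have hpos : 0 < ‖f‖ + 1 := by positivity
    have hne : ((‖f‖ + 1 : ℝ) : ℂ) ≠ 0 := by exact_mod_cast hpos.ne'
    have h2 := h1 ((((‖f‖ + 1 : ℝ) : ℂ)⁻¹) • f) (by
      rw [norm_smul, norm_inv, Complex.norm_real, Real.norm_of_nonneg hpos.le,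
        inv_mul_le_iff₀ hpos]
      linarith [norm_nonneg f])
    have h3 := (blochSubmodule X μ).smul_mem ((‖f‖ + 1 : ℝ) : ℂ) h2
    rw [← cesaro_smul, ← BlochSpace.coe_smul, smul_inv_smul₀ hne] at h3
    exact h3
  refine ⟨cesaroLinearMap hφ hmem, fun f z => rfl, ?_⟩
  set T := cesaroLinearMap (ω := ω) (μ := μ) hφ hmem
  refine ⟨T '' Metric.closedBall 0 1, ?_, mem_of_superset
    (Metric.closedBall_mem_nhds 0 one_pos) fun f hf => mem_image_of_mem T hf⟩
  rw [isCompact_iff_ultrafilter_le_nhds]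
  intro V hV
  have hV' : T '' Metric.closedBall 0 1 ∈ V := le_principal_iff.mp hV
  -- Pulling the ultrafilter back to the unit ball of the source gives a pointwise limit `F`, whose
  -- image is the required cluster point.
  set U := Ultrafilter.ofComapInfPrincipal hV'
  have hU : ∀ᶠ g in (U : Filter (BlochSpace X ω)), ‖g‖ ≤ 1 := by
    filter_upwards [Ultrafilter.ofComapInfPrincipal_mem hV'] with g hg
    simpa using hg
  obtain ⟨F, hF, hlim⟩ := BlochSpace.exists_tendsto_of_ultrafilter U hU
  refine ⟨T F, mem_image_of_mem T (by simpa using hF), ?_⟩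
  rw [← Ultrafilter.ofComapInfPrincipal_eq_of_map hV']
  change Tendsto T U (𝓝 (T F))
  rw [Metric.tendsto_nhds]
  intro ε hε
  -- The criterion is applied to `g - F`, of norm at most `2`; the two terms contribute at most `ε /
  -- 4` each.
  obtain ⟨K, hK, hKB, A, hA0, hA⟩ := H (ε / 4) (by positivity)
  have hη : 0 < ε / (4 * (A + 1)) := by positivity
  filter_upwards [hU, BlochSpace.eventually_forall_mem_compact hU hF hlim hK hKB hη] with g hg hgK
  rw [dist_eq_norm, ← map_sub]
  have hle := norm_cesaro_le (g := T (g - F)) (f := g - F) hφ rfl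
    (hA (g - F) ((norm_sub_le g F).trans (by linarith)) _ hη.le hgK)
  have : A * (ε / (4 * (A + 1))) ≤ ε / 4 := by
    rw [mul_div_assoc', div_le_div_iff₀ (by positivity) (by positivity)]
    nlinarith
  linarith

end Compactness

/-! ### Convergence or divergence of the integral in terms of its primitive -/

section Integrability

variable {ω : NormalFunction}

theorem NormalFunction.ofReal_primitive {r : ℝ} (hr : r ∈ Ico (0 : ℝ) 1) :
    ENNReal.ofReal (ω.primitive r) = ∫⁻ t in Ioc (0 : ℝ) r, ENNReal.ofReal (1 / ω t) := by
  rw [primitive, intervalIntegral.integral_of_le hr.1, ofReal_integral_eq_lintegral_ofReal]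
  · exact (ω.intervalIntegrable_one_div ⟨le_rfl, one_pos⟩ hr).1
  · filter_upwards [ae_restrict_mem measurableSet_Ioc] with t ht
    exact (one_div_pos.mpr (ω.pos t ⟨ht.1.le, ht.2.trans_lt hr.2⟩)).le

theorem NormalFunction.primitive_le_of_lintegral_lt_top
    (h : (∫⁻ t in Ioo (0 : ℝ) 1, ENNReal.ofReal (1 / ω t)) < ⊤) :
    ∃ L, ∀ r ∈ Ico (0 : ℝ) 1, ω.primitive r ≤ L := by
  refine ⟨(∫⁻ t in Ioo (0 : ℝ) 1, ENNReal.ofReal (1 / ω t)).toReal, fun r hr => ?_⟩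
  rw [← ENNReal.ofReal_le_iff_le_toReal h.ne, ω.ofReal_primitive hr]
  exact lintegral_mono_set fun t ht => ⟨ht.1, ht.2.trans_lt hr.2⟩

/-- By monotone convergence along `(0, 1 - 1/(n+1)]`, a bound on all the primitives would bound the
full integral. -/
theorem NormalFunction.exists_lt_primitive_of_lintegral_eq_top
    (h : (∫⁻ t in Ioo (0 : ℝ) 1, ENNReal.ofReal (1 / ω t)) = ⊤) (L : ℝ) :
    ∃ r ∈ Ico (0 : ℝ) 1, L < ω.primitive r := by
  by_contra! hL
  let r : ℕ → ℝ := fun n => 1 - 1 / ((n : ℝ) + 1)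
  have hr : ∀ n, r n ∈ Ico (0 : ℝ) 1 := fun n => by
    have h1 : (0 : ℝ) < 1 / ((n : ℝ) + 1) := by positivity
    have h2 : 1 / ((n : ℝ) + 1) ≤ 1 := by
      rw [div_le_one (by positivity)]
      linarith [n.cast_nonneg (α := ℝ)]
    exact ⟨by simp only [r]; linarith, by simp only [r]; linarith⟩
  have hmono : Monotone r := fun m n hmn => by
    have : 1 / ((n : ℝ) + 1) ≤ 1 / ((m : ℝ) + 1) := by gcongr
    simp only [r]
    linarith
  have hunion : Ioo (0 : ℝ) 1 ⊆ ⋃ n, Ioc (0 : ℝ) (r n) := by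
    intro t ht
    obtain ⟨n, hn⟩ := exists_nat_one_div_lt (sub_pos.mpr ht.2)
    exact mem_iUnion.mpr ⟨n, ht.1, by simp only [r]; linarith⟩
  have hdir : Directed (· ⊆ ·) fun n => Ioc (0 : ℝ) (r n) :=
    Monotone.directed_le fun m n hmn => Ioc_subset_Ioc_right (hmono hmn)
  have hle := lintegral_mono_set (μ := volume) (f := fun t => ENNReal.ofReal (1 / ω t)) hunion
  rw [h, setLIntegral_iUnion_of_directed _ hdir, top_le_iff] at hle
  refine absurd hle (ne_top_of_le_ne_top ENNReal.ofReal_ne_top (iSup_le fun n => ?_)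
    (b := ENNReal.ofReal L))
  rw [← ω.ofReal_primitive (hr n)]
  exact ENNReal.ofReal_le_ofReal (hL _ (hr n))

end Integrability

/-! ### Sufficiency, and necessity in the convergent case -/

section Sufficiency

variable {X : Type*} [NormedAddCommGroup X] [NormedSpace ℂ X] {ω μ : NormalFunction}
  {φ : Metric.ball (0 : X) 1 → ℂ} {ε ρ : ℝ}

theorem mem_exceptionalSet (hρ : ρ ∈ Ioo (0 : ℝ) 1) {z : Metric.ball (0 : X) 1}
    (hz : ‖(z : X)‖ ≤ ρ) (h : ε ≤ weighted μ φ z) : (z : X) ∈ exceptionalSet μ φ ε ρ := by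
  refine ⟨z.2, hz, 1, ⟨le_rfl, (one_le_inv₀ hρ.1).mpr hρ.2.le⟩, by simp, ?_⟩
  simpa using h

/-- The dilation by `s = ‖z‖/ρ`, at most `1/ρ`, carries the radial projection back to `z`. This is
why the exceptional set allows dilations. -/
theorem smul_mem_exceptionalSet (hρ : ρ ∈ Ioo (0 : ℝ) 1) {z : Metric.ball (0 : X) 1}
    (hz : ρ ≤ ‖(z : X)‖) (h : ε ≤ weighted μ φ z) :
    ((ρ / ‖(z : X)‖ : ℝ) : ℂ) • (z : X) ∈ exceptionalSet μ φ ε ρ := by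
  have hz1 : ‖(z : X)‖ < 1 := mem_ball_zero_iff.mp z.2
  have hz0 : 0 < ‖(z : X)‖ := hρ.1.trans_le hz
  have hnorm : ‖((ρ / ‖(z : X)‖ : ℝ) : ℂ) • (z : X)‖ = ρ := by
    rw [norm_ofReal_smul (div_pos hρ.1 hz0).le]
    field_simp
  have hs : ((‖(z : X)‖ / ρ : ℝ) : ℂ) • ((ρ / ‖(z : X)‖ : ℝ) : ℂ) • (z : X) = z := by
    rw [smul_smul, ← Complex.ofReal_mul, div_mul_div_cancel₀ hρ.1.ne', div_self hz0.ne']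
    simp
  refine ⟨by rw [mem_ball_zero_iff, hnorm]; exact hρ.2, hnorm.le, ‖(z : X)‖ / ρ,
    ⟨(one_le_div hρ.1).mpr hz, ?_⟩, by rw [hs]; exact z.2, ?_⟩
  · rw [← one_div]
    gcongr
    exact hρ.1.le
  · simpa only [hs] using h

theorem tendsto_weighted_mul_primitive_iff :
    Tendsto (fun z : Metric.ball (0 : X) 1 => weighted μ φ z * ω.primitive ‖(z : X)‖)
      (comap (fun z : Metric.ball (0 : X) 1 => ‖(z : X)‖) (𝓝[<] 1)) (𝓝 0) ↔
    ∀ ε > 0, ∃ ρ < (1 : ℝ), ∀ z : Metric.ball (0 : X) 1, ρ < ‖(z : X)‖ →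
      weighted μ φ z * ω.primitive ‖(z : X)‖ < ε := by
  have hbasis := (nhdsLT_basis (1 : ℝ)).comap fun z : Metric.ball (0 : X) 1 => ‖(z : X)‖
  rw [hbasis.tendsto_iff Metric.nhds_basis_ball]
  refine forall₂_congr fun ε _ => exists_congr fun ρ =>
    and_congr_right fun _ => forall_congr' fun z => ?_
  have hz : ‖(z : X)‖ < 1 := mem_ball_zero_iff.mp z.2
  have h0 : 0 ≤ weighted μ φ z * ω.primitive ‖(z : X)‖ :=
    mul_nonneg (weighted_nonneg μ φ z) (ω.primitive_nonneg ⟨norm_nonneg _, hz⟩)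
  simp only [mem_preimage, mem_Ioo, hz, and_true, mem_ball_zero_iff, Real.norm_of_nonneg h0]

/-- A bounded monotone function has small oscillation near the end of the interval. The bound `1/2 ≤
ρ` is what `norm_sub_smul_le` needs. -/
theorem NormalFunction.exists_primitive_sub_le {L : ℝ} (hL : ∀ r ∈ Ico (0 : ℝ) 1, ω.primitive r ≤ L)
    {η : ℝ} (hη : 0 < η) : ∃ ρ ∈ Ioo (0 : ℝ) 1, 1 / 2 ≤ ρ ∧
      ∀ r ∈ Ico ρ 1, ω.primitive r - ω.primitive ρ ≤ η := by
  have hbdd : BddAbove (ω.primitive '' Ico 0 1) := ⟨L, forall_mem_image.mpr hL⟩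
  obtain ⟨_, ⟨ρ, hρ, rfl⟩, hlt⟩ := exists_lt_of_lt_csSup
    ((nonempty_Ico.mpr one_pos).image ω.primitive) (sub_lt_self (sSup (ω.primitive '' Ico 0 1)) hη)
  have hmax : max ρ (1 / 2) ∈ Ico (0 : ℝ) 1 :=
    ⟨le_max_of_le_left hρ.1, max_lt hρ.2 (by norm_num)⟩
  refine ⟨max ρ (1 / 2), ⟨lt_max_of_lt_right (by norm_num), hmax.2⟩, le_max_right _ _,
    fun r hr => ?_⟩
  have h1 := le_csSup hbdd (mem_image_of_mem _ ⟨hmax.1.trans hr.1, hr.2⟩)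
  have h2 := ω.monotoneOn_primitive hρ hmax (le_max_left _ _)
  linarith

theorem cesaroCompact_of_memBloch (hφ : MemBloch μ φ)
    (hE : ∀ ε > (0 : ℝ), ∀ ρ ∈ Ioo (0 : ℝ) 1, RelativelyCompactInBall (exceptionalSet μ φ ε ρ))
    {L : ℝ} (hL : ∀ r ∈ Ico (0 : ℝ) 1, ω.primitive r ≤ L) : CesaroCompact ω μ φ := by
  refine cesaroCompact_of_forall hφ.1 fun ε hε => ?_
  obtain ⟨A, hA⟩ := hφ.2
  have hA' : ∀ z, weighted μ φ z ≤ A := fun z => hA ⟨z, rfl⟩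
  have hA0 : 0 ≤ A := (weighted_nonneg μ φ BlochSpace.origin).trans (hA' _)
  set G := 1 + 1 / ω (1 / 2) + 2 * L with hG
  have hgrowth : ∀ r ∈ Ico (0 : ℝ) 1, ω.growth r ≤ G := fun r hr => by
    have := hL r hr
    rw [NormalFunction.growth]
    linarith
  have hG0 : 0 < G := (ω.growth_pos ⟨le_rfl, one_pos⟩).trans_le (hgrowth 0 ⟨le_rfl, one_pos⟩)
  -- With `‖f‖ ≤ 2`, radial variation beyond `ρ` is at most `4η = ε/(A+1)`, which the bound `A` on
  -- `μ |ℛφ|` turns into at most `ε`.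
  obtain ⟨ρ, hρ, hρ2, hρη⟩ := NormalFunction.exists_primitive_sub_le hL
    (η := ε / (4 * (A + 1))) (by positivity)
  -- Since `|f| ≤ 2G`, points below this threshold contribute at most `ε`.
  obtain ⟨K, hK, hEK, hKB⟩ := hE (ε / (2 * G)) (by positivity) ρ hρ
  refine ⟨K, hK, hKB, A, hA0, fun f hf s hs0 hs z => ?_⟩
  have hz1 : ‖(z : X)‖ < 1 := mem_ball_zero_iff.mp z.2
  have hw0 := weighted_nonneg μ φ z
  rw [← extendZero_coe f z]
  rcases lt_or_ge (weighted μ φ z) (ε / (2 * G)) with hlt | hge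
  · have h1 : ‖extendZero f (z : X)‖ ≤ 2 * G := (f.norm_apply_le z.2).trans
      (mul_le_mul hf (hgrowth _ ⟨norm_nonneg _, hz1⟩)
        (ω.growth_pos ⟨norm_nonneg _, hz1⟩).le zero_le_two)
    calc weighted μ φ z * ‖extendZero f (z : X)‖ ≤ ε / (2 * G) * (2 * G) := by gcongr
      _ = ε := by field_simp
      _ ≤ ε + A * s := le_add_of_nonneg_right (by positivity)
  · rcases le_total ‖(z : X)‖ ρ with hz | hz
    · have h1 := hs z (hEK (mem_exceptionalSet hρ hz hge))
      calc weighted μ φ z * ‖extendZero f (z : X)‖ ≤ A * s := by gcongr; exact hA' z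
        _ ≤ ε + A * s := le_add_of_nonneg_left hε.le
    · have hz0 : 0 < ‖(z : X)‖ := hρ.1.trans_le hz
      have h1 := hs _ (hEK (smul_mem_exceptionalSet hρ hz hge))
      have hθ : ρ / ‖(z : X)‖ * ‖(z : X)‖ = ρ := by field_simp
      have h2 := norm_sub_smul_le f.mem.1 f.weighted_le_norm z.2
        (θ := ρ / ‖(z : X)‖) (div_pos hρ.1 hz0) ((div_le_one hz0).mpr hz) (by rwa [hθ])
      rw [hθ] at h2
      have h3 := hρη _ ⟨hz, hz1⟩
      have h4 : 0 ≤ ω.primitive ‖(z : X)‖ - ω.primitive ρ := sub_nonneg.mpr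
        (ω.monotoneOn_primitive ⟨hρ.1.le, hρ.2⟩ ⟨norm_nonneg _, hz1⟩ hz)
      have h5 : 2 * ‖f‖ * (ω.primitive ‖(z : X)‖ - ω.primitive ρ) ≤ ε / (A + 1) := by
        calc 2 * ‖f‖ * (ω.primitive ‖(z : X)‖ - ω.primitive ρ)
            ≤ 2 * 2 * (ε / (4 * (A + 1))) := by gcongr
          _ = ε / (A + 1) := by field_simp; norm_num
      have h6 := norm_le_norm_add_norm_sub' (extendZero f (z : X))
        (extendZero f (((ρ / ‖(z : X)‖ : ℝ) : ℂ) • (z : X)))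
      have h7 : A * (ε / (A + 1)) ≤ ε := by
        rw [mul_div_assoc', div_le_iff₀ (by positivity)]
        nlinarith
      calc weighted μ φ z * ‖extendZero f (z : X)‖ ≤ A * (s + ε / (A + 1)) := by
            gcongr
            · exact hA' z
            · linarith
        _ ≤ ε + A * s := by linarith

theorem cesaroCompact_of_tendsto (hφ : IsHolomorphic φ)
    (hE : ∀ ε > (0 : ℝ), ∀ ρ ∈ Ioo (0 : ℝ) 1, RelativelyCompactInBall (exceptionalSet μ φ ε ρ))
    (hω : ∀ L, ∃ r ∈ Ico (0 : ℝ) 1, L < ω.primitive r)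
    (h : ∀ ε > 0, ∃ ρ < (1 : ℝ), ∀ z : Metric.ball (0 : X) 1, ρ < ‖(z : X)‖ →
      weighted μ φ z * ω.primitive ‖(z : X)‖ < ε) : CesaroCompact ω μ φ := by
  refine cesaroCompact_of_forall hφ fun ε hε => ?_
  obtain ⟨ρ₁, hρ₁, h1⟩ := h (ε / 6) (by positivity)
  -- Beyond `ρ₂` the primitive exceeds the constants in `growth`, so `|f| ≤ 6 ω.primitive ‖z‖` when
  -- `‖f‖ ≤ 2`; hence the `ε / 6` above.
  obtain ⟨ρ₂, hρ₂, h2⟩ := hω (1 + 1 / ω (1 / 2))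
  set ρ := max (max ρ₁ ρ₂) (1 / 2)
  have hρ : ρ ∈ Ioo (0 : ℝ) 1 :=
    ⟨lt_max_of_lt_right (by norm_num), max_lt (max_lt hρ₁ hρ₂.2) (by norm_num)⟩
  have hG0 : 0 < ω.growth ρ := ω.growth_pos ⟨hρ.1.le, hρ.2⟩
  obtain ⟨K, hK, hEK, hKB⟩ := hE (ε / (2 * ω.growth ρ)) (by positivity) ρ hρ
  have hcont : ContinuousOn (fun x : X => μ ‖x‖ * ‖radialDeriv φ x‖) K := by
    refine ContinuousOn.mul ?_ ?_
    · exact μ.continuousOn.comp continuous_norm.continuousOn fun x hx =>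
        ⟨norm_nonneg x, mem_ball_zero_iff.mp (hKB hx)⟩
    · exact (hφ.differentiableOn_radialDeriv.continuousOn.mono hKB).norm
  obtain ⟨A, hA⟩ := hK.exists_bound_of_continuousOn hcont
  refine ⟨K, hK, hKB, |A|, abs_nonneg A, fun f hf s hs0 hs z => ?_⟩
  have hz1 : ‖(z : X)‖ < 1 := mem_ball_zero_iff.mp z.2
  have hw0 := weighted_nonneg μ φ z
  have hfz := (f.norm_apply_le z.2).trans (mul_le_mul_of_nonneg_right hf
    (ω.growth_pos ⟨norm_nonneg _, hz1⟩).le)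
  have hs' : 0 ≤ |A| * s := by positivity
  rw [← extendZero_coe f z]
  rcases lt_or_ge ρ ‖(z : X)‖ with hz | hz
  · have h3 := h1 z (lt_of_le_of_lt ((le_max_left _ _).trans (le_max_left _ _)) hz)
    have h4 : ω.primitive ρ₂ ≤ ω.primitive ‖(z : X)‖ :=
      ω.monotoneOn_primitive hρ₂ ⟨norm_nonneg _, hz1⟩
        (((le_max_right _ _).trans (le_max_left _ _)).trans hz.le)
    have h5 : ‖extendZero f (z : X)‖ ≤ 6 * ω.primitive ‖(z : X)‖ := by
      rw [NormalFunction.growth] at hfz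
      linarith
    calc weighted μ φ z * ‖extendZero f (z : X)‖
        ≤ weighted μ φ z * (6 * ω.primitive ‖(z : X)‖) := by gcongr
      _ ≤ ε + |A| * s := by linarith
  · rcases lt_or_ge (weighted μ φ z) (ε / (2 * ω.growth ρ)) with hlt | hge
    · have h3 := ω.growth_mono ⟨norm_nonneg _, hz1⟩ ⟨hρ.1.le, hρ.2⟩ hz
      calc weighted μ φ z * ‖extendZero f (z : X)‖
          ≤ ε / (2 * ω.growth ρ) * (2 * ω.growth ρ) := by
            gcongr
            linarith
        _ = ε := by field_simp
        _ ≤ ε + |A| * s := by linarith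
    · have hzK := hEK (mem_exceptionalSet hρ hz hge)
      have h3 : weighted μ φ z ≤ |A| :=
        (le_abs_self _).trans ((hA z hzK).trans (le_abs_self A))
      calc weighted μ φ z * ‖extendZero f (z : X)‖ ≤ |A| * s := by
            gcongr
            exact hs z hzK
        _ ≤ ε + |A| * s := by linarith

/-- The image of the constant function `1` has radial derivative `ℛφ`. -/
theorem memBloch_of_cesaroCompact (hφ : IsHolomorphic φ) (h : CesaroCompact ω μ φ) :
    MemBloch μ φ := by
  obtain ⟨T, hT, -⟩ := h
  have hd : ∀ z ∈ Metric.ball (0 : X) 1,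
      HasFDerivAt (extendZero fun _ : Metric.ball (0 : X) 1 => (1 : ℂ)) (0 : X →L[ℂ] ℂ) z := by
    intro z hz
    refine (hasFDerivAt_const (1 : ℂ) z).congr_of_eventuallyEq ?_
    filter_upwards [Metric.isOpen_ball.mem_nhds hz] with y hy
    exact extendZero_of_mem hy
  let e : BlochSpace X ω := ⟨fun _ => 1, fun z hz =>
      (hd z hz).differentiableAt.differentiableWithinAt, 0, by
    rintro _ ⟨z, rfl⟩
    simp [weighted, radialDeriv, (hd z z.2).fderiv]⟩
  have hTe : ⇑(T e) = cesaro φ e := funext (hT e)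
  refine ⟨hφ, ?_⟩
  have hbdd := (T e).mem.2
  rw [hTe] at hbdd
  convert hbdd using 2
  funext z
  rw [weighted_cesaro μ hφ e.mem.1, show e z = 1 from rfl, norm_one, mul_one]

end Sufficiency

/-! ### Global comparison estimates for normal functions -/

section Comparison

/-- A positive continuous function on `[0, 1)` that is antitone near `1` is antitone on `[0, 1)` up
to a constant factor. -/
theorem exists_le_mul_of_antitoneOn {p : ℝ → ℝ} {δ : ℝ} (hδ : δ ∈ Ico (0 : ℝ) 1)
    (hp : ∀ r ∈ Ico (0 : ℝ) 1, 0 < p r) (hc : ContinuousOn p (Ico 0 1))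
    (ha : AntitoneOn p (Ico δ 1)) :
    ∃ C > 0, ∀ x ∈ Ico (0 : ℝ) 1, ∀ y ∈ Ico (0 : ℝ) 1, x ≤ y → p y ≤ C * p x := by
  have hsub : Icc 0 δ ⊆ Ico (0 : ℝ) 1 := fun t ht => ⟨ht.1, ht.2.trans_lt hδ.2⟩
  have hne : (Icc 0 δ).Nonempty := nonempty_Icc.mpr hδ.1
  obtain ⟨u, hu, hmin⟩ := isCompact_Icc.exists_isMinOn hne (hc.mono hsub)
  obtain ⟨v, hv, hmax⟩ := isCompact_Icc.exists_isMaxOn hne (hc.mono hsub)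
  have hpu := hp u (hsub hu)
  have huv : p u ≤ p v := hmax hu
  have hle : ∀ x ∈ Icc 0 δ, p v ≤ p v / p u * p x := fun x hx => by
    rw [div_mul_eq_mul_div, le_div_iff₀ hpu]
    exact mul_le_mul_of_nonneg_left (hmin hx) (hpu.le.trans huv)
  -- The constant is the ratio of the maximum to the minimum of `p` on `[0, δ]`, the part where
  -- monotonicity may fail.
  refine ⟨p v / p u, div_pos (hpu.trans_le huv) hpu, fun x hx y hy hxy => ?_⟩
  rcases le_total y δ with h | h
  · exact (hmax ⟨hy.1, h⟩ : p y ≤ p v).trans (hle x ⟨hx.1, hxy.trans h⟩)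
  · rcases le_total x δ with h' | h'
    · exact ((ha ⟨le_rfl, hδ.2⟩ ⟨h, hy.2⟩ h).trans (hmax ⟨hδ.1, le_rfl⟩)).trans (hle x ⟨hx.1, h'⟩)
    · exact (ha ⟨h', hx.2⟩ ⟨h, hy.2⟩ hxy).trans
        (le_mul_of_one_le_left (hp x hx).le ((one_le_div hpu).mpr huv))

/-- Up to a constant factor, the monotonicity properties in the definition of a normal function
hold on all of `[0, 1)`. -/
theorem NormalFunction.exists_comparison (ω : NormalFunction) :
    ∃ a > 0, ∃ b > 0, ∃ C > 0, ∀ x ∈ Ico (0 : ℝ) 1, ∀ y ∈ Ico (0 : ℝ) 1, x ≤ y →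
      1 / ω x ≤ C / ω y * ((1 - y) / (1 - x)) ^ (a : ℝ) ∧
      1 / ω y ≤ C / ω x * ((1 - x) / (1 - y)) ^ (b : ℝ) := by
  obtain ⟨δ, hδ, a, b, ha, hab, hanti, hmono⟩ := ω.normal
  have hpow : ∀ c : ℝ, ∀ r ∈ Ico (0 : ℝ) 1, 0 < (1 - r) ^ c := fun c r hr =>
    Real.rpow_pos_of_pos (sub_pos.mpr hr.2) c
  have hpowc : ∀ c : ℝ, ContinuousOn (fun r : ℝ => (1 - r) ^ c) (Ico 0 1) := fun c =>
    (continuousOn_const.sub continuousOn_id).rpow_const fun r hr => .inl (sub_pos.mpr hr.2).ne'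
  have hsub : Ico δ 1 ⊆ Ico (0 : ℝ) 1 := Ico_subset_Ico_left hδ.1
  obtain ⟨C₁, hC₁, h₁⟩ := exists_le_mul_of_antitoneOn hδ
    (fun r hr => div_pos (ω.pos r hr) (hpow a r hr))
    (ω.continuousOn.div (hpowc a) fun r hr => (hpow a r hr).ne') hanti
  -- The increasing quotient is inverted so that the antitone lemma applies.
  obtain ⟨C₂, hC₂, h₂⟩ := exists_le_mul_of_antitoneOn hδ (p := fun r => (1 - r) ^ b / ω r)
    (fun r hr => div_pos (hpow b r hr) (ω.pos r hr))
    ((hpowc b).div ω.continuousOn fun r hr => (ω.pos r hr).ne') (by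
      intro x hx y hy hxy
      have := hmono hx hy hxy
      have h := one_div_le_one_div_of_le (div_pos (ω.pos x (hsub hx)) (hpow b x (hsub hx))) this
      simpa only [one_div_div] using h)
  refine ⟨a, ha, b, ha.trans hab, max C₁ C₂, lt_max_of_lt_left hC₁, fun x hx y hy hxy => ?_⟩
  have hx' := sub_pos.mpr hx.2
  have hy' := sub_pos.mpr hy.2
  have hωx := ω.pos x hx
  have hωy := ω.pos y hy
  rw [Real.div_rpow hy'.le hx'.le, Real.div_rpow hx'.le hy'.le]
  have hax := hpow a x hx
  have hay := hpow a y hy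
  have hbx := hpow b x hx
  have hby := hpow b y hy
  constructor
  · have h := (h₁ x hx y hy hxy).trans
      (mul_le_mul_of_nonneg_right (le_max_left C₁ C₂) (div_pos hωx hax).le)
    rw [div_le_iff₀ hay] at h
    rw [div_mul_div_comm, div_le_div_iff₀ hωx (by positivity)]
    calc 1 * (ω y * (1 - x) ^ a)
        ≤ (max C₁ C₂ * (ω x / (1 - x) ^ a) * (1 - y) ^ a) * (1 - x) ^ a := by
          rw [one_mul]
          gcongr
      _ = max C₁ C₂ * (1 - y) ^ a * ω x := by field_simp
  · have h := (h₂ x hx y hy hxy).trans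
      (mul_le_mul_of_nonneg_right (le_max_right C₁ C₂) (div_pos hbx hωx).le)
    rw [div_le_iff₀ hωy] at h
    rw [div_mul_div_comm, div_le_div_iff₀ hωy (by positivity)]
    calc 1 * (ω x * (1 - y) ^ b)
        ≤ ω x * (max C₁ C₂ * ((1 - x) ^ b / ω x) * ω y) := by
          rw [one_mul]
          gcongr
      _ = max C₁ C₂ * (1 - x) ^ b * ω y := by field_simp

end Comparison

/-! ### Dyadic sums adapted to a normal weight -/

section DyadicSums

/-- The dyadic points `1 - 2⁻ᵏ`. -/
def node (k : ℕ) : ℝ := 1 - (1 / 2) ^ k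

theorem node_mem (k : ℕ) : node k ∈ Ico (0 : ℝ) 1 :=
  ⟨sub_nonneg.mpr (pow_le_one₀ (by norm_num) (by norm_num)), sub_lt_self _ (by positivity)⟩

theorem one_sub_node (k : ℕ) : 1 - node k = (1 / 2) ^ k := sub_sub_cancel _ _

theorem node_le_node_succ (k : ℕ) : node k ≤ node (k + 1) := by
  rw [node, node, pow_succ]
  have : (0 : ℝ) < (1 / 2) ^ k := by positivity
  linarith

/-- A two-sided geometric sum, bounded by telescoping `v / (1 + v)`. -/
theorem sum_le_of_two_sided {q v C : ℝ} (hq : 1 < q) (hv : 0 < v) (hC : 0 ≤ C) {t : ℕ → ℝ}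
    (h : ∀ k, (v * q ^ k ≤ 1 ∧ t k ≤ C * (v * q ^ k)) ∨ (1 ≤ v * q ^ k ∧ t k ≤ C / (v * q ^ k)))
    (n : ℕ) : ∑ k ∈ Finset.range n, t k ≤ 2 * C * (1 + q) / (q - 1) := by
  have hq1 : 0 < q - 1 := sub_pos.mpr hq
  have hq0 : 0 < q := one_pos.trans hq
  set K := 2 * C * (1 + q) / (q - 1) with hK
  have hK0 : 0 ≤ K := by positivity
  have hterm : ∀ k, t k ≤
      K * (v * q ^ (k + 1) / (1 + v * q ^ (k + 1))) - K * (v * q ^ k / (1 + v * q ^ k)) := by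
    intro k
    have hw : 0 < v * q ^ k := by positivity
    have hkk := h k
    rw [pow_succ, ← mul_assoc]
    generalize v * q ^ k = w at hw hkk ⊢
    have heq : K * (w * q / (1 + w * q)) - K * (w / (1 + w))
        = 2 * C * (1 + q) * w / ((1 + w * q) * (1 + w)) := by
      rw [hK]
      field_simp
      ring
    rw [heq, le_div_iff₀ (by positivity)]
    rcases hkk with ⟨hw1, ht⟩ | ⟨hw1, ht⟩
    · calc t k * ((1 + w * q) * (1 + w)) ≤ C * w * ((1 + 1 * q) * (1 + 1)) := by gcongr
        _ = 2 * C * (1 + q) * w := by ring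
    · calc t k * ((1 + w * q) * (1 + w)) ≤ C / w * ((w + w * q) * (w + w)) := by gcongr
        _ = 2 * C * (1 + q) * w := by field_simp; ring
  refine (Finset.sum_le_sum fun k _ => hterm k).trans ?_
  rw [Finset.sum_range_sub fun k => K * (v * q ^ k / (1 + v * q ^ k))]
  have h1 : v * q ^ n / (1 + v * q ^ n) ≤ 1 := by
    rw [div_le_one (by positivity)]
    linarith
  have h2 : 0 ≤ K * (v * q ^ 0 / (1 + v * q ^ 0)) := by positivity
  nlinarith

/-- With `w = (1 - x) / 2⁻ᵏ`, the terms with `node k ≤ x` are at most `C/ω(x) · w^a`. The others are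
at most `C/ω(x) · w^(b-m-1)`, where the kernel factor beats the growth `w^b` because `m > b`. Both
sides decay geometrically away from `w = 1`. -/
theorem NormalFunction.exists_sum_le (ω : NormalFunction) :
    ∃ m : ℕ, ∃ C > 0, ∀ x ∈ Ico (0 : ℝ) 1, ∀ n,
      ∑ k ∈ Finset.range n, ((1 / 2) ^ k / (1 - node k * x)) ^ (m + 1) / ω (node k) ≤ C / ω x := by
  obtain ⟨a, ha, b, hb, C, hC, hcomp⟩ := ω.exists_comparison
  obtain ⟨m, hm⟩ := exists_nat_gt b
  -- A single exponent serving both sides of the sum.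
  set c : ℝ := min a (m + 1 - b) with hc
  have hc0 : 0 < c := lt_min ha (by linarith)
  set q : ℝ := 2 ^ c with hqdef
  have hq : 1 < q := Real.one_lt_rpow one_lt_two hc0
  have hq1 : 0 < q - 1 := sub_pos.mpr hq
  refine ⟨m, 2 * C * (1 + q) / (q - 1), by positivity, fun x hx n => ?_⟩
  have hωx := ω.pos x hx
  have hu : 0 < 1 - x := sub_pos.mpr hx.2
  have hsum := sum_le_of_two_sided (v := (1 - x) ^ c) (C := C / ω x) hq
    (Real.rpow_pos_of_pos hu c) (by positivity)
    (t := fun k => ((1 / 2) ^ k / (1 - node k * x)) ^ (m + 1) / ω (node k)) ?_ n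
  · refine hsum.trans_eq ?_
    field_simp
  · intro k
    have hh : (0 : ℝ) < (1 / 2) ^ k := by positivity
    have hv : (1 - x) ^ c * q ^ k = ((1 - x) / (1 / 2) ^ k) ^ c := by
      rw [Real.div_rpow hu.le hh.le, hqdef, ← Real.rpow_natCast ((2 : ℝ) ^ c) k,
        ← Real.rpow_mul zero_le_two, ← Real.rpow_natCast (1 / 2 : ℝ) k, ← Real.rpow_mul (by norm_num),
        mul_comm (k : ℝ) c, one_div, Real.inv_rpow zero_le_two, div_inv_eq_mul]
    have hnode := node_mem k
    have hωk := ω.pos _ hnode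
    have hk := one_sub_node k
    rw [hv]
    rcases le_total (node k) x with h | h
    · left
      have hw0 : 0 < (1 - x) / (1 / 2) ^ k := by positivity
      have hw1 : (1 - x) / (1 / 2) ^ k ≤ 1 := by
        rw [div_le_one hh, ← hk]
        linarith
      refine ⟨Real.rpow_le_one hw0.le hw1 hc0.le, ?_⟩
      have h1 : (1 / 2) ^ k / (1 - node k * x) ≤ 1 := by
        rw [div_le_one (by nlinarith [hnode.1, hnode.2, hx.1, hx.2]), ← hk]
        nlinarith [hnode.1, hx.2]
      have h0 : 0 ≤ (1 / 2) ^ k / (1 - node k * x) :=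
        div_nonneg hh.le (by nlinarith [hnode.1, hnode.2, hx.1, hx.2])
      calc ((1 / 2) ^ k / (1 - node k * x)) ^ (m + 1) / ω (node k)
          ≤ 1 / ω (node k) := by gcongr; exact pow_le_one₀ h0 h1
        _ ≤ C / ω x * ((1 - x) / (1 / 2) ^ k) ^ a := by
            have := (hcomp _ hnode x hx h).1
            rwa [hk] at this
        _ ≤ C / ω x * ((1 - x) / (1 / 2) ^ k) ^ c := by
            gcongr ?_ * ?_
            exact Real.rpow_le_rpow_of_exponent_ge hw0 hw1 (min_le_left _ _)
    · right
      have hw1 : 1 ≤ (1 - x) / (1 / 2) ^ k := by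
        rw [one_le_div hh, ← hk]
        linarith
      have hw0 : 0 < (1 - x) / (1 / 2) ^ k := by positivity
      refine ⟨Real.one_le_rpow hw1 hc0.le, ?_⟩
      have hden : 1 - x ≤ 1 - node k * x := by nlinarith [hnode.2, hx.1]
      have h2 := (hcomp x hx _ hnode h).2
      rw [hk] at h2
      calc ((1 / 2) ^ k / (1 - node k * x)) ^ (m + 1) / ω (node k)
          = ((1 / 2) ^ k / (1 - node k * x)) ^ (m + 1) * (1 / ω (node k)) := div_eq_mul_one_div _ _
        _ ≤ ((1 / 2) ^ k / (1 - x)) ^ (m + 1) * (C / ω x * ((1 - x) / (1 / 2) ^ k) ^ b) := by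
            gcongr
            exact div_nonneg hh.le (hu.le.trans hden)
        _ = C / ω x * (((1 - x) / (1 / 2) ^ k) ^ b /
              ((1 - x) / (1 / 2) ^ k) ^ ((m + 1 : ℕ) : ℝ)) := by
            rw [Real.rpow_natCast, ← inv_div (1 - x), inv_pow]
            ring
        _ = C / ω x * ((1 - x) / (1 / 2) ^ k) ^ (b - (m + 1 : ℕ)) := by
            rw [Real.rpow_sub hw0]
        _ ≤ C / ω x * ((1 - x) / (1 / 2) ^ k) ^ (-c) := by
            gcongr ?_ * ?_
            refine Real.rpow_le_rpow_of_exponent_le hw1 ?_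
            push_cast
            linarith [min_le_right a (m + 1 - b)]
        _ = C / ω x / ((1 - x) / (1 / 2) ^ k) ^ c := by
            rw [Real.rpow_neg hw0.le, div_eq_mul_inv (C / ω x)]

/-- On one dyadic interval `1 - t` drops by at most a factor `2`, so `1/ω` grows there by at most `C
· 2^b`. -/
theorem NormalFunction.exists_primitive_le_sum (ω : NormalFunction) :
    ∃ C > 0, ∀ n, ∀ r ∈ Ico (0 : ℝ) 1, r ≤ node n →
      ω.primitive r ≤ C * ∑ k ∈ Finset.range n, (1 / 2) ^ k / ω (node k) := by
  obtain ⟨a, ha, b, hb, C, hC, hcomp⟩ := ω.exists_comparison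
  refine ⟨C * 2 ^ b, by positivity, fun n r hr hrn => ?_⟩
  refine (ω.monotoneOn_primitive hr (node_mem n) hrn).trans ?_
  clear hr hrn
  induction n with
  | zero => simp [node, primitive]
  | succ n ih =>
    rw [Finset.sum_range_succ, mul_add]
    have hωn := ω.pos _ (node_mem n)
    have hpn : (0 : ℝ) < (1 / 2) ^ n := by positivity
    have hint : ω.primitive (node (n + 1)) - ω.primitive (node n)
        ≤ C * 2 ^ b * ((1 / 2) ^ n / ω (node n)) := by
      rw [ω.primitive_sub (node_mem n) (node_mem (n + 1))]
      have hbound : ∀ t ∈ uIoc (node n) (node (n + 1)), ‖1 / ω t‖ ≤ C / ω (node n) * 2 ^ b := by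
        intro t ht
        rw [uIoc_of_le (node_le_node_succ n)] at ht
        have ht' : t ∈ Ico (0 : ℝ) 1 :=
          ⟨(node_mem n).1.trans ht.1.le, ht.2.trans_lt (node_mem (n + 1)).2⟩
        rw [Real.norm_of_nonneg (one_div_pos.mpr (ω.pos t ht')).le]
        refine (hcomp _ (node_mem n) t ht' ht.1.le).2.trans ?_
        have h1 : (1 / 2) ^ n / 2 ≤ 1 - t := by
          have := one_sub_node (n + 1)
          rw [pow_succ] at this
          linarith [ht.2]
        have h2 : (1 - node n) / (1 - t) ≤ 2 := by
          rw [one_sub_node, div_le_iff₀ (by linarith)]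
          linarith
        have h3 : 0 ≤ (1 - node n) / (1 - t) :=
          div_nonneg (sub_nonneg.mpr (node_mem n).2.le) (sub_nonneg.mpr ht'.2.le)
        gcongr
      refine (le_abs_self _).trans
        ((intervalIntegral.norm_integral_le_of_norm_le_const hbound).trans ?_)
      have hlen : |node (n + 1) - node n| ≤ (1 / 2) ^ n := by
        rw [abs_of_nonneg (sub_nonneg.mpr (node_le_node_succ n))]
        linarith [one_sub_node n, (node_mem (n + 1)).2]
      calc C / ω (node n) * 2 ^ b * |node (n + 1) - node n|
          ≤ C / ω (node n) * 2 ^ b * (1 / 2) ^ n := by gcongr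
        _ = C * 2 ^ b * ((1 / 2) ^ n / ω (node n)) := by ring
    linarith

end DyadicSums

/-! ### Extremal test functions -/

section TestFunctions

variable (ω : NormalFunction) (m n : ℕ)

/-- A finite sum of dyadic Cauchy-type kernels: a function on the unit disc whose derivative is
dominated by `1 / ω` and whose values on the radius `[0, 1)` are comparable to the primitive
of `1 / ω`. -/
def kernelSum (c : ℂ) : ℂ :=
  ∑ k ∈ Finset.range n,
    ((((1 / 2) ^ k) ^ (m + 1) / ω (node k) : ℝ) : ℂ) * ((1 - node k * c) ^ m)⁻¹

/-- The derivative of `kernelSum`. -/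
def kernelSumDeriv (c : ℂ) : ℂ :=
  ∑ k ∈ Finset.range n, ((((1 / 2) ^ k) ^ (m + 1) / ω (node k) : ℝ) : ℂ) *
    (m * node k * ((1 - node k * c) ^ (m + 1))⁻¹)

theorem one_sub_node_mul_pos {x : ℝ} (hx : x < 1) (k : ℕ) : 0 < 1 - node k * x := by
  have := node_mem k
  nlinarith [this.1, this.2]

theorem one_sub_le_norm_one_sub_node_mul {c : ℂ} {x : ℝ} (hc : ‖c‖ ≤ x) (k : ℕ) :
    1 - node k * x ≤ ‖1 - node k * c‖ := by
  have h1 := norm_sub_norm_le (1 : ℂ) (node k * c)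
  rw [norm_one, norm_mul, Complex.norm_real, Real.norm_of_nonneg (node_mem k).1] at h1
  have h2 := mul_le_mul_of_nonneg_left hc (node_mem k).1
  linarith

theorem one_sub_node_mul_ne_zero {c : ℂ} (hc : ‖c‖ < 1) (k : ℕ) : (1 - node k * c : ℂ) ≠ 0 :=
  norm_pos_iff.mp ((one_sub_node_mul_pos hc k).trans_le
    (one_sub_le_norm_one_sub_node_mul le_rfl k))

theorem hasDerivAt_kernelSum {c : ℂ} (hc : ‖c‖ < 1) :
    HasDerivAt (kernelSum ω m n) (kernelSumDeriv ω m n c) c := by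
  unfold kernelSum kernelSumDeriv
  refine HasDerivAt.fun_sum fun k _ => HasDerivAt.const_mul _ ?_
  have hne := one_sub_node_mul_ne_zero hc k
  have h1 : HasDerivAt (fun c : ℂ => 1 - node k * c) (-(node k : ℂ)) c := by
    simpa using ((hasDerivAt_id c).const_mul (node k : ℂ)).const_sub 1
  convert (h1.fun_pow m).fun_inv (pow_ne_zero m hne) using 1
  rcases m with _ | m
  · simp
  · rw [Nat.add_sub_cancel]
    field_simp
    ring

theorem norm_kernelSumDeriv_le {C x : ℝ} (hx : x ∈ Ico (0 : ℝ) 1)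
    (hC : ∑ k ∈ Finset.range n, ((1 / 2) ^ k / (1 - node k * x)) ^ (m + 1) / ω (node k) ≤ C / ω x)
    {c : ℂ} (hc : ‖c‖ ≤ x) : ‖kernelSumDeriv ω m n c‖ ≤ m * (C / ω x) := by
  refine le_trans ?_ (mul_le_mul_of_nonneg_left hC m.cast_nonneg)
  rw [Finset.mul_sum]
  refine norm_sum_le_of_le _ fun k _ => ?_
  have hω := ω.pos _ (node_mem k)
  have hpos := one_sub_node_mul_pos hx.2 k
  have hle := one_sub_le_norm_one_sub_node_mul hc k
  have hk := node_mem k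
  rw [norm_mul, norm_mul, norm_mul, norm_inv, norm_pow, Complex.norm_real, Complex.norm_real,
    Complex.norm_natCast, Real.norm_of_nonneg (by positivity), Real.norm_of_nonneg hk.1]
  calc ((1 / 2 : ℝ) ^ k) ^ (m + 1) / ω (node k) * (m * node k * (‖1 - node k * c‖ ^ (m + 1))⁻¹)
      ≤ ((1 / 2 : ℝ) ^ k) ^ (m + 1) / ω (node k) * (m * 1 * ((1 - node k * x) ^ (m + 1))⁻¹) := by
        gcongr
        exact hk.2.le
    _ = m * (((1 / 2) ^ k / (1 - node k * x)) ^ (m + 1) / ω (node k)) := by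
        rw [div_pow ((1 / 2 : ℝ) ^ k) (1 - node k * x), mul_one]
        generalize ((1 / 2 : ℝ) ^ k) ^ (m + 1) = u
        ring

theorem norm_kernelSum_zero_le {C : ℝ}
    (hC : ∑ k ∈ Finset.range n, ((1 / 2) ^ k / (1 - node k * 0)) ^ (m + 1) / ω (node k) ≤ C / ω 0) :
    ‖kernelSum ω m n 0‖ ≤ C / ω 0 := by
  refine le_trans (norm_sum_le_of_le _ fun k _ => ?_) hC
  have hω := ω.pos _ (node_mem k)
  simp only [mul_zero, sub_zero, one_pow, inv_one, mul_one, div_one]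
  rw [Complex.norm_real, Real.norm_of_nonneg (by positivity)]

/-- The bound may depend on `n`: it is only needed for the finitely many functions of a net. -/
theorem exists_norm_kernelSum_le : ∃ B, ∀ c : ℂ, ‖c‖ < 1 → ‖kernelSum ω m n c‖ ≤ B := by
  refine ⟨∑ k ∈ Finset.range n,
    ((1 / 2) ^ k) ^ (m + 1) / ω (node k) * ((1 - node k * 1) ^ m)⁻¹, fun c hc =>
    norm_sum_le_of_le _ fun k _ => ?_⟩
  have hω := ω.pos _ (node_mem k)
  have hle := one_sub_le_norm_one_sub_node_mul hc.le k
  have hpos : 0 < 1 - node k * 1 := by linarith [(node_mem k).2]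
  rw [norm_mul, norm_inv, norm_pow, Complex.norm_real, Real.norm_of_nonneg (by positivity)]
  gcongr

/-- On the radius all terms are positive, so nothing cancels. For `k ≤ n` one has `1 - node k * r ≤
2⁻ᵏ + 2⁻ⁿ ≤ 2 · 2⁻ᵏ`, which costs the factor `2^m`. -/
theorem le_norm_kernelSum_ofReal {r : ℝ} (hr : r < 1) (hn : node n ≤ r) :
    (∑ k ∈ Finset.range (n + 1), (1 / 2) ^ k / ω (node k)) / 2 ^ m ≤
      ‖kernelSum ω m (n + 1) (r : ℂ)‖ := by
  have hreal : kernelSum ω m (n + 1) (r : ℂ) = ((∑ k ∈ Finset.range (n + 1),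
      ((1 / 2) ^ k) ^ (m + 1) / ω (node k) * ((1 - node k * r) ^ m)⁻¹ : ℝ) : ℂ) := by
    rw [kernelSum, Complex.ofReal_sum]
    refine Finset.sum_congr rfl fun k _ => ?_
    push_cast
    rfl
  rw [hreal, Complex.norm_real]
  refine le_trans ?_ (le_abs_self _)
  rw [Finset.sum_div]
  refine Finset.sum_le_sum fun k hk => ?_
  have hω := ω.pos _ (node_mem k)
  have hpos := one_sub_node_mul_pos hr k
  have hkn : k ≤ n := Nat.lt_succ_iff.mp (Finset.mem_range.mp hk)
  have hle : 1 - node k * r ≤ 2 * (1 / 2) ^ k := by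
    have h1 : ((1 : ℝ) / 2) ^ n ≤ (1 / 2) ^ k :=
      pow_le_pow_of_le_one (by norm_num) (by norm_num) hkn
    have h2 := one_sub_node k
    have h3 := one_sub_node n
    nlinarith [(node_mem k).1, (node_mem k).2]
  calc (1 / 2 : ℝ) ^ k / ω (node k) / 2 ^ m
      = ((1 / 2) ^ k) ^ (m + 1) / ω (node k) * ((2 * (1 / 2) ^ k) ^ m)⁻¹ := by
        rw [mul_pow, pow_succ]
        field_simp
    _ ≤ ((1 / 2) ^ k) ^ (m + 1) / ω (node k) * ((1 - node k * r) ^ m)⁻¹ := by gcongr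

variable (X : Type*) [NormedAddCommGroup X] [NormedSpace ℂ X]

/-- There is a bounded family of bounded functions in the Bloch-type space that attain the maximal
growth at prescribed points. -/
theorem exists_bounded_extremal : ∃ C > 0, ∀ z : Metric.ball (0 : X) 1, ∃ f : BlochSpace X ω,
    ‖f‖ ≤ C ∧ ω.primitive ‖(z : X)‖ ≤ C * ‖f z‖ ∧ ∃ B, ∀ w, ‖f w‖ ≤ B := by
  obtain ⟨m, C₁, hC₁, h₁⟩ := ω.exists_sum_le
  obtain ⟨C₂, hC₂, h₂⟩ := ω.exists_primitive_le_sum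
  have h0mem : (0 : ℝ) ∈ Ico (0 : ℝ) 1 := ⟨le_rfl, one_pos⟩
  have hω0 := ω.pos 0 h0mem
  refine ⟨C₁ / ω 0 + m * C₁ + C₂ * 2 ^ m, by positivity, fun z => ?_⟩
  have hz1 : ‖(z : X)‖ < 1 := mem_ball_zero_iff.mp z.2
  -- This places `node n ≤ ‖z‖ < node (n + 1)`: the right inequality bounds the primitive by the sum
  -- of `n + 1` terms, the left one makes each of those terms visible at `z`.
  obtain ⟨n, hn1, hn2⟩ := exists_nat_pow_near_of_lt_one (x := 1 - ‖(z : X)‖) (y := (1 / 2 : ℝ))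
    (by linarith) (by linarith [norm_nonneg (z : X)]) (by norm_num) (by norm_num)
  rw [← one_sub_node] at hn1 hn2
  -- A norming functional reduces the construction to the disc: `l z = ‖z‖` and `|l w| ≤ ‖w‖`.
  obtain ⟨l, hl, hlz⟩ := exists_dual_vector'' ℂ (z : X)
  have hlw : ∀ w : X, ‖l w‖ ≤ ‖w‖ := fun w => by
    simpa using l.le_of_opNorm_le hl w
  have hd : ∀ w ∈ Metric.ball (0 : X) 1, HasFDerivAt
      (extendZero fun w : Metric.ball (0 : X) 1 => kernelSum ω m (n + 1) (l w))
      (kernelSumDeriv ω m (n + 1) (l w) • l) w := by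
    intro w hw
    have hw1 : ‖l w‖ < 1 := (hlw w).trans_lt (mem_ball_zero_iff.mp hw)
    refine ((hasDerivAt_kernelSum ω m (n + 1) hw1).comp_hasFDerivAt w
      l.hasFDerivAt).congr_of_eventuallyEq ?_
    filter_upwards [Metric.isOpen_ball.mem_nhds hw] with y hy
    exact extendZero_of_mem hy
  have hweighted : ∀ w, weighted ω
      (fun w : Metric.ball (0 : X) 1 => kernelSum ω m (n + 1) (l w)) w ≤ m * C₁ := by
    intro w
    have hw1 : ‖(w : X)‖ < 1 := mem_ball_zero_iff.mp w.2
    have hωw := ω.pos_norm w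
    rw [weighted, radialDeriv, (hd w w.2).fderiv, smul_apply, smul_eq_mul,
      norm_mul]
    have h3 := norm_kernelSumDeriv_le ω m (n + 1) ⟨norm_nonneg _, hw1⟩
      (h₁ _ ⟨norm_nonneg _, hw1⟩ (n + 1)) (hlw w)
    calc ω ‖(w : X)‖ * (‖kernelSumDeriv ω m (n + 1) (l w)‖ * ‖l w‖)
        ≤ ω ‖(w : X)‖ * (m * (C₁ / ω ‖(w : X)‖) * 1) := by
          gcongr
          exact (hlw w).trans hw1.le
      _ = m * C₁ := by field_simp
  let f : BlochSpace X ω := ⟨fun w => kernelSum ω m (n + 1) (l w),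
    fun w hw => (hd w hw).differentiableAt.differentiableWithinAt, m * C₁, by
      rintro _ ⟨w, rfl⟩
      exact hweighted w⟩
  refine ⟨f, f.norm_le_of_forall fun w => ?_, ?_, ?_⟩
  · have h3 : ‖f BlochSpace.origin‖ ≤ C₁ / ω 0 := by
      change ‖kernelSum ω m (n + 1) (l (0 : X))‖ ≤ _
      rw [map_zero]
      exact norm_kernelSum_zero_le ω m (n + 1) (h₁ 0 h0mem (n + 1))
    have h4 : weighted ω f w ≤ m * C₁ := hweighted w
    have h5 : 0 ≤ C₂ * 2 ^ m := by positivity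
    linarith
  · have h3 := h₂ (n + 1) _ ⟨norm_nonneg _, hz1⟩ (by linarith)
    have h4 := le_norm_kernelSum_ofReal ω m n hz1 (by linarith)
    have h5 : f z = kernelSum ω m (n + 1) ((‖(z : X)‖ : ℝ) : ℂ) := by
      change kernelSum ω m (n + 1) (l z) = _
      rw [hlz]
      rfl
    rw [← h5, div_le_iff₀ (by positivity)] at h4
    calc ω.primitive ‖(z : X)‖ ≤ C₂ * (‖f z‖ * 2 ^ m) :=
          h3.trans (mul_le_mul_of_nonneg_left h4 hC₂.le)
      _ = C₂ * 2 ^ m * ‖f z‖ := by ring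
      _ ≤ _ := by
        gcongr
        exact le_add_of_nonneg_left (by positivity)
  · obtain ⟨B, hB⟩ := exists_norm_kernelSum_le ω m (n + 1)
    exact ⟨B, fun w => hB _ ((hlw w).trans_lt (mem_ball_zero_iff.mp w.2))⟩

end TestFunctions

/-! ### Necessity in the divergent case -/

section Necessity

variable {X : Type*} [NormedAddCommGroup X] [NormedSpace ℂ X] {ω μ : NormalFunction}
  {φ : Metric.ball (0 : X) 1 → ℂ}

theorem weighted_mul_primitive_lt_of_cesaroCompact (hφ : IsHolomorphic φ)
    (hω : ∀ L, ∃ r ∈ Ico (0 : ℝ) 1, L < ω.primitive r) (h : CesaroCompact ω μ φ) :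
    ∀ ε > 0, ∃ ρ < (1 : ℝ), ∀ z : Metric.ball (0 : X) 1, ρ < ‖(z : X)‖ →
      weighted μ φ z * ω.primitive ‖(z : X)‖ < ε := by
  intro ε hε
  obtain ⟨T, hT, hTc⟩ := h
  obtain ⟨C, hC, hex⟩ := exists_bounded_extremal ω X
  choose f hfC hfW hfB using hex
  obtain ⟨K, hK, hTK⟩ := hTc.image_closedBall_subset_compact C
  have htb : TotallyBounded (range fun z => T (f z)) := hK.totallyBounded.subset <| by
    rintro _ ⟨z, rfl⟩
    exact hTK (mem_image_of_mem T (by simpa using hfC z))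
  have hη : 0 < ε / (4 * C) := by positivity
  obtain ⟨t, htr, htfin, htcov⟩ := Metric.finite_approx_of_totallyBounded htb _ hη
  have htr' : ∀ y ∈ t, ∃ w, T (f w) = y := fun y hy => htr hy
  have : Nonempty (Metric.ball (0 : X) 1) := ⟨BlochSpace.origin⟩
  choose! s hs using htr'
  choose B hB using hfB
  obtain ⟨B₀, hB₀⟩ := (htfin.image fun y => B (s y)).bddAbove
  -- Beyond this radius `|f_z(z)| ≥ 2 B₀`, so subtracting a function of the net, bounded by `B₀`,
  -- loses at most half of the value at `z`.
  obtain ⟨ρ, hρ, hρW⟩ := hω (2 * C * B₀)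
  refine ⟨ρ, hρ.2, fun z hz => ?_⟩
  have hz1 : ‖(z : X)‖ < 1 := mem_ball_zero_iff.mp z.2
  have hw := weighted_nonneg μ φ z
  obtain ⟨y, hyt, hy⟩ := mem_iUnion₂.mp (htcov (mem_range_self z))
  rw [Metric.mem_ball, dist_eq_norm, ← hs y hyt, ← map_sub] at hy
  have h1 := (T (f z - f (s y))).weighted_le_norm z
  rw [show ⇑(T (f z - f (s y))) = cesaro φ ⇑(f z - f (s y)) from funext (hT _),
    weighted_cesaro μ hφ (f z - f (s y)).mem.1] at h1
  have h2 : ‖f z z‖ - B₀ ≤ ‖(f z - f (s y)) z‖ := by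
    have h3 := norm_sub_norm_le (f z z) (f (s y) z)
    have h4 := (hB (s y) z).trans (hB₀ (mem_image_of_mem (fun y => B (s y)) hyt))
    exact (sub_le_sub_left h4 _).trans h3
  have h3 : 2 * C * B₀ ≤ C * ‖f z z‖ := hρW.le.trans
    ((ω.monotoneOn_primitive hρ ⟨norm_nonneg _, hz1⟩ hz.le).trans (hfW z))
  have h4 : ‖f z z‖ ≤ 2 * ‖(f z - f (s y)) z‖ := by
    have : 2 * B₀ ≤ ‖f z z‖ := le_of_mul_le_mul_left (by linarith) hC
    linarith
  calc weighted μ φ z * ω.primitive ‖(z : X)‖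
      ≤ weighted μ φ z * (C * (2 * ‖(f z - f (s y)) z‖)) := by
        gcongr
        exact (hfW z).trans (by gcongr)
    _ = 2 * C * (weighted μ φ z * ‖(f z - f (s y)) z‖) := by ring
    _ ≤ 2 * C * (ε / (4 * C)) := by
        gcongr
        exact h1.trans hy.le
    _ = ε / 2 := by field_simp; norm_num
    _ < ε := half_lt_self hε

end Necessity

end BlochBall

end

theorem theorem4p2 {X : Type*} [NormedAddCommGroup X] [NormedSpace ℂ X] [CompleteSpace X]
    (ω μ : BlochBall.NormalFunction) (φ : Metric.ball (0 : X) 1 → ℂ)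
    (hφ : BlochBall.IsHolomorphic φ)
    (hE : ∀ ε > (0 : ℝ), ∀ ρ ∈ Set.Ioo (0 : ℝ) 1,
      BlochBall.RelativelyCompactInBall (BlochBall.exceptionalSet μ φ ε ρ)) :
    ((∫⁻ t in Set.Ioo (0 : ℝ) 1, ENNReal.ofReal (1 / ω t)) < ⊤ →
      (BlochBall.CesaroCompact ω μ φ ↔ BlochBall.MemBloch μ φ)) ∧
    ((∫⁻ t in Set.Ioo (0 : ℝ) 1, ENNReal.ofReal (1 / ω t)) = ⊤ →
      (BlochBall.CesaroCompact ω μ φ ↔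
        Filter.Tendsto
          (fun z : Metric.ball (0 : X) 1 =>
            BlochBall.weighted μ φ z * ∫ t in (0 : ℝ)..‖(z : X)‖, 1 / ω t)
          (Filter.comap (fun z : Metric.ball (0 : X) 1 => ‖(z : X)‖) (nhdsWithin 1 (Set.Iio 1)))
          (nhds 0))) := by
  refine ⟨fun hfin => ⟨BlochBall.memBloch_of_cesaroCompact hφ, fun hmem => ?_⟩, fun htop => ?_⟩
  · obtain ⟨L, hL⟩ := BlochBall.NormalFunction.primitive_le_of_lintegral_lt_top hfin
    exact BlochBall.cesaroCompact_of_memBloch hmem hE hL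
  · have hω := BlochBall.NormalFunction.exists_lt_primitive_of_lintegral_eq_top htop
    refine Iff.trans ?_ BlochBall.tendsto_weighted_mul_primitive_iff.symm
    exact ⟨BlochBall.weighted_mul_primitive_lt_of_cesaroCompact hφ hω,
      BlochBall.cesaroCompact_of_tendsto hφ hE hω⟩
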